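/- Let $G=(V,E)$ be a connected graph that is either finite, or infinite of bounded degree. Consider the edge-averaging process $(f_t)_{t\ge 0}$ on $G$: every vertex $v$ has an opinion $f_t(v)\in\mathbb R$ at each time $t\ge 0$; the edges carry independent unit-rate Poisson clocks, which are independent of the initial opinions $\{f_0(v)\}_{v\in V}$; when the clock of an edge $uv$ rings at time $t$, both endpoints update to the average of their opinions just before, $f_t(u)=f_t(v)=\frac12\big(f_{t-}(u)+f_{t-}(v)\big)$, and the opinion of a vertex does not change otherwise. Suppose that the initial opinions $\{f_0(v)\}_{v\in V}$ are i.i.d. with values in $[-1,1]$, and let $\mu:=\mathbb E[f_0(v)]$ be their common expectation. Then for every vertex $o\in V$, every $t\ge 0$ and every $0\le\varepsilon<1$, $$\mathbb P\big(|f_t(o)-\mu|\ge\varepsilon\big)\le 3\exp\Big(-\frac{\varepsilon^2\sqrt{t_*}}{12}\Big),$$ where $t_*:=\min(t,|V|^2)$ (so $t_*=t$ if $V$ is infinite). -/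

import Mathlib

open MeasureTheory ProbabilityTheory Filter Topology Set
open scoped NNReal

/-- A unit-rate Poisson counting process on `[0, ∞)`: `N t` is the number of rings during `(0, t]`.
Almost every path starts at `0`, is nondecreasing and right-continuous; increments over
disjoint intervals are independent, and the increment over `(s, t]` has the Poisson law with mean
`t - s`. (The paths being a.s. nondecreasing, the subtraction in `ℕ` is the true one a.s.) -/
structure IsUnitPoissonProcess {Ω : Type*} [MeasurableSpace Ω]
    (N : ℝ≥0 → Ω → ℕ) (P : Measure Ω) : Prop where
  measurable : ∀ t, Measurable (N t)
  zero : ∀ᵐ ω ∂P, N 0 ω = 0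
  monotone : ∀ᵐ ω ∂P, Monotone fun t => N t ω
  rightContinuous : ∀ᵐ ω ∂P, ∀ t, ContinuousWithinAt (fun s => N s ω) (Ici t) t
  indepIncrements : HasIndepIncrements N P
  law : ∀ s t, s ≤ t → HasLaw (fun ω => N t ω - N s ω) (poissonMeasure (t - s)) P

/-- The clock with counting path `n` rings at time `t`: `n` jumps at `t > 0`. -/
def Rings (n : ℝ≥0 → ℕ) (t : ℝ≥0) : Prop :=
  0 < t ∧ ∀ s < t, n s < n t

/-- The (deterministic) edge-averaging rule. Here `n e` is the counting path of the clock of the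
edge `e`, and `x t v` is the opinion of the vertex `v` at time `t`. Whenever the clock of an edge
`uv` rings, `u` and `v` both replace their opinion by the average of their two opinions just before
(left limits, whose existence is part of the rule); and the opinion of a vertex stays constant
as long as no edge at this vertex rings. -/
structure FollowsEdgeAveraging {V : Type*} (G : SimpleGraph V)
    (n : G.edgeSet → ℝ≥0 → ℕ) (x : ℝ≥0 → V → ℝ) : Prop where
  average : ∀ (u v : V) (h : G.Adj u v) (t : ℝ≥0),
    Rings (n ⟨s(u, v), G.mem_edgeSet.2 h⟩) t →
      ∃ a b : ℝ, Tendsto (fun s => x s u) (𝓝[<] t) (𝓝 a) ∧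
        Tendsto (fun s => x s v) (𝓝[<] t) (𝓝 b) ∧
        x t u = (a + b) / 2 ∧ x t v = (a + b) / 2
  constant : ∀ (v : V) (s t : ℝ≥0), s ≤ t →
    (∀ (w : V) (h : G.Adj v w), ∀ r ∈ Ioc s t,
      ¬ Rings (n ⟨s(v, w), G.mem_edgeSet.2 h⟩) r) →
    x t v = x s v

/-- `f` is the edge-averaging process on `G` driven by the clocks `N`, on the probability
space `(Ω, P)`: the clocks of the edges are independent unit-rate Poisson processes, the family of
initial opinions is independent of the family of clocks, and almost surely the opinions follow the
edge-averaging rule. No joint law of the initial opinions is prescribed here. -/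
structure IsEdgeAveragingProcess {V Ω : Type*} [MeasurableSpace Ω] (G : SimpleGraph V)
    (N : G.edgeSet → ℝ≥0 → Ω → ℕ) (f : ℝ≥0 → V → Ω → ℝ) (P : Measure Ω) : Prop where
  clock : ∀ e, IsUnitPoissonProcess (N e) P
  clock_indep : iIndepFun (fun e ω t => N e t ω) P
  initial_measurable : ∀ v, Measurable (f 0 v)
  initial_indep_clock : IndepFun (fun ω v => f 0 v ω) (fun ω e t => N e t ω) P
  follows : ∀ᵐ ω ∂P, FollowsEdgeAveraging G (fun e t => N e t ω) (fun t v => f t v ω)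

open Classical in
/-- `t_* = min (t, |V|²)`, which is `t` if `V` is infinite. -/
noncomputable def tStar (V : Type*) (t : ℝ≥0) : ℝ :=
  if Finite V then min (t : ℝ) ((Nat.card V : ℝ) ^ 2) else t

/-! ### Deterministic behaviour of the averaging rule -/

/-! Read backward from time t, the clocks express f_t(o) as a weighted mean Σ w(v) f_0(v): w starts
as the unit mass at o, and each ring averages the weights at the two ends of its edge. The weights
depend on the clocks alone, so Hoeffding's inequality, for given w, bounds the deviation probability
by 2 exp(-ε²/(2Q)) with Q = Σ w(v)² (`measure_le_abs_linearCombination_sub_le`). It remains to show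
that Q ≤ q := 6/√t_* outside an event of probability at most exp(-ε²√t_*/12).

A ring of uv lowers Q by (w(u) - w(v))²/2. Let M ≥ Q be the largest weight. While Q > q, some weight
is at most M/2. Since the total mass is 1, a simple path from the maximum to its first such vertex
has at most 2/M edges, and Cauchy–Schwarz gives Σ (w(u) - w(v))² ≥ M³/8 along it
(`exists_edges_sum_sq_ge`). So 1/Q grows at a rate of order at least Q, and exp(-1/Q), set to 0 once
Q ≤ q, decays in mean at rate q/17 (`sum_truncExp_le`). Markov's inequality yields P(Q > q) ≤
exp(1/q - tq/17).

With infinitely many clocks the rings cannot be listed in order of time. Hence time is cut into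
steps of length h, and only the finitely many edges near the support of w are watched
(`historyChain`). Two or more rings there in one step count as failure. Each ring adds at most one
vertex to the support, so bounded degree makes the failure probability O(h)
(`measure_historyChain_eq_none_le`), and h tends to 0. -/

lemma exists_rings_of_eq_add_one {m : ℝ≥0 → ℕ} (hm : Monotone m)
    (hc : ∀ t, ContinuousWithinAt m (Ici t) t) {a b : ℝ≥0} (h : m b = m a + 1) :
    ∃ r ∈ Ioc a b, Rings m r ∧ (∀ s, a ≤ s → s < r → m s = m a) ∧
      (∀ s, r ≤ s → s ≤ b → m s = m b) := by
  set S : Set ℝ≥0 := {s | m a < m s} with hS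
  have hbS : b ∈ S := by simp [hS, h]
  have hbdd : BddBelow S := OrderBot.bddBelow S
  set r := sInf S with hr
  have hrb : r ≤ b := csInf_le hbdd hbS
  -- The infimum is attained: by right-continuity into the discrete space ℕ, `m` is constant just to
  -- the right of `r`, where `S` has points.
  have hmr : m a < m r := by
    by_contra hcon
    have h1 : ∀ᶠ s in 𝓝[≥] r, m s = m r := by
      have := hc r
      rw [ContinuousWithinAt, nhds_discrete, tendsto_pure] at this
      exact this
    obtain ⟨c, hc1, hc2⟩ := (mem_nhdsGE_iff_exists_Ico_subset' (lt_add_one r)).1 h1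
    obtain ⟨s, hs, hsc⟩ := exists_lt_of_csInf_lt ⟨b, hbS⟩ (show sInf S < c from hc1)
    have h2 : m s = m r := hc2 ⟨csInf_le hbdd hs, hsc⟩
    have h3 : m a < m s := hs
    omega
  have har : a < r := by
    by_contra hcon
    have := hm (not_lt.1 hcon)
    omega
  have hlow : ∀ s, a ≤ s → s < r → m s = m a := fun s has hsr =>
    le_antisymm (not_lt.1 fun hlt => notMem_of_lt_csInf hsr hbdd hlt) (hm has)
  refine ⟨r, ⟨har, hrb⟩, ⟨(zero_le).trans_lt har, fun s hs => ?_⟩, hlow, fun s h1 h2 => ?_⟩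
  · refine lt_of_le_of_lt ?_ hmr
    exact not_lt.1 fun hlt => notMem_of_lt_csInf hs hbdd hlt
  · have := hm h1; have := hm h2; omega

lemma not_rings_of_eq {m : ℝ≥0 → ℕ} (hm : Monotone m) {a b : ℝ≥0} (h : m b = m a) :
    ∀ r ∈ Ioc a b, ¬ Rings m r := fun r hr hR => by
  have := hR.2 a hr.1
  have := hm hr.2
  omega

namespace FollowsEdgeAveraging

variable {V : Type*} {G : SimpleGraph V} {n : G.edgeSet → ℝ≥0 → ℕ} {x : ℝ≥0 → V → ℝ}

lemma eq_of_silent (hx : FollowsEdgeAveraging G n x) (hm : ∀ e, Monotone (n e)) {v : V}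
    {a b : ℝ≥0} (hab : a ≤ b) (h : ∀ e : G.edgeSet, v ∈ e.1 → n e b = n e a) : x b v = x a v :=
  hx.constant v a b hab fun _ _ => not_rings_of_eq (hm _) (h _ (Sym2.mem_mk_left _ _))

/-- No other edge at `u` or `v` rings in the window, so the left limits at the ring are the opinions
at time `a`, and the average persists until `b`. -/
lemma eq_average (hx : FollowsEdgeAveraging G n x) (hm : ∀ e, Monotone (n e))
    (hc : ∀ e t, ContinuousWithinAt (n e) (Ici t) t) {u v : V} (huv : G.Adj u v)
    {a b : ℝ≥0} (e : G.edgeSet) (he : e.1 = s(u, v)) (hone : n e b = n e a + 1)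
    (h : ∀ e' : G.edgeSet, (u ∈ e'.1 ∨ v ∈ e'.1) → e' ≠ e → n e' b = n e' a) :
    x b u = (x a u + x a v) / 2 ∧ x b v = (x a u + x a v) / 2 := by
  obtain rfl : e = ⟨s(u, v), G.mem_edgeSet.2 huv⟩ := Subtype.ext he
  set e : G.edgeSet := ⟨s(u, v), G.mem_edgeSet.2 huv⟩ with hedef
  obtain ⟨r, hr, hR, hlow, hhigh⟩ := exists_rings_of_eq_add_one (hm e) (hc e) hone
  have key : ∀ z, (z = u ∨ z = v) → (∀ s, a ≤ s → s < r → x s z = x a z) ∧ x b z = x r z := by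
    intro z hz
    have hinc : ∀ e' : G.edgeSet, z ∈ e'.1 → e' ≠ e → n e' b = n e' a := by
      intro e' he' hne
      refine h e' ?_ hne
      rcases hz with rfl | rfl
      · exact Or.inl he'
      · exact Or.inr he'
    refine ⟨fun s has hsr => hx.eq_of_silent hm has fun e' he' => ?_,
      hx.eq_of_silent hm hr.2 fun e' he' => ?_⟩
    · by_cases hee : e' = e
      · rw [hee]; exact hlow s has hsr
      · have := hinc e' he' hee
        have h1 := hm e' has
        have h2 := hm e' (hsr.le.trans hr.2)
        omega
    · by_cases hee : e' = e
      · rw [hee]; exact (hhigh r le_rfl hr.2).symm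
      · have := hinc e' he' hee
        have h1 := hm e' hr.1.le
        have h2 := hm e' hr.2
        omega
  obtain ⟨α, β, hα, hβ, hu, hv⟩ := hx.average u v huv r hR
  have hne : (𝓝[<] r).NeBot := nhdsLT_neBot_of_exists_lt ⟨a, hr.1⟩
  have lim : ∀ z γ, (z = u ∨ z = v) → Tendsto (fun s => x s z) (𝓝[<] r) (𝓝 γ) → γ = x a z := by
    intro z γ hz hγ
    refine tendsto_nhds_unique hγ (tendsto_const_nhds.congr' ?_)
    filter_upwards [Ico_mem_nhdsLT hr.1] with s hs
    exact ((key z hz).1 s hs.1 hs.2).symm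
  rw [lim u α (Or.inl rfl) hα, lim v β (Or.inr rfl) hβ] at hu hv
  exact ⟨(key u (Or.inl rfl)).2.trans hu, (key v (Or.inr rfl)).2.trans hv⟩

end FollowsEdgeAveraging

/-! ### Averaging of finitely supported weights -/

section Weights

variable {V : Type*}

/-- The weights after averaging the masses at `u` and `v`. -/
noncomputable def averageAt (u v : V) (w : V →₀ ℝ) : V →₀ ℝ :=
  w + ((w v - w u) / 2) • (Finsupp.single u 1 - Finsupp.single v 1)

lemma linearCombination_averageAt (u v : V) (w : V →₀ ℝ) (x : V → ℝ) :
    Finsupp.linearCombination ℝ x (averageAt u v w) =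
      Finsupp.linearCombination ℝ x w + (w v - w u) / 2 * (x u - x v) := by
  simp [averageAt, Finsupp.linearCombination_single]

lemma averageAt_apply_left {u v : V} (h : u ≠ v) (w : V →₀ ℝ) :
    averageAt u v w u = (w u + w v) / 2 := by
  simp [averageAt, h]; ring

lemma averageAt_apply_right {u v : V} (h : u ≠ v) (w : V →₀ ℝ) :
    averageAt u v w v = (w u + w v) / 2 := by
  simp [averageAt, h.symm]; ring

lemma averageAt_apply_of_ne {u v z : V} (hu : z ≠ u) (hv : z ≠ v) (w : V →₀ ℝ) :
    averageAt u v w z = w z := by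
  simp [averageAt, hu, hv]

lemma averageAt_nonneg {u v : V} (h : u ≠ v) {w : V →₀ ℝ} (hw : ∀ z, 0 ≤ w z) (z : V) :
    0 ≤ averageAt u v w z := by
  by_cases hu : z = u
  · subst hu; rw [averageAt_apply_left h]; linarith [hw z, hw v]
  by_cases hv : z = v
  · subst hv; rw [averageAt_apply_right h]; linarith [hw z, hw u]
  · rw [averageAt_apply_of_ne hu hv]; exact hw z

/-- The sum of the squares of the weights. -/
noncomputable def sumSq (w : V →₀ ℝ) : ℝ := Finsupp.linearCombination ℝ w w

lemma sumSq_eq (w : V →₀ ℝ) : sumSq w = ∑ v ∈ w.support, w v ^ 2 := by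
  simp [sumSq, Finsupp.linearCombination_apply, Finsupp.sum, pow_two]

lemma linearCombination_eq_sum (w : V →₀ ℝ) (x : V → ℝ) :
    Finsupp.linearCombination ℝ x w = ∑ v ∈ w.support, w v * x v := by
  simp [Finsupp.linearCombination_apply, Finsupp.sum]

/-- `sumSq` is a bilinear form on the diagonal, so the update is expanded in one argument at a time
and no sum over a changing support is needed. -/
lemma sumSq_averageAt {u v : V} (h : u ≠ v) (w : V →₀ ℝ) :
    sumSq (averageAt u v w) = sumSq w - (w u - w v) ^ 2 / 2 := by
  have key : ∀ w' : V →₀ ℝ, Finsupp.linearCombination ℝ (averageAt u v w) w' =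
      Finsupp.linearCombination ℝ w w' + (w v - w u) / 2 * (w' u - w' v) := by
    intro w'
    induction w' using Finsupp.induction_linear with
    | zero => simp
    | add f g hf hg => rw [map_add, map_add, hf, hg]; simp; ring
    | single z c =>
      simp only [Finsupp.linearCombination_single, smul_eq_mul]
      by_cases hu : z = u
      · subst hu; rw [averageAt_apply_left h]; simp [h]; ring
      by_cases hv : z = v
      · subst hv; rw [averageAt_apply_right h]; simp [h]; ring
      · rw [averageAt_apply_of_ne hu hv]; simp [hu, hv]
  rw [sumSq, key, linearCombination_averageAt, averageAt_apply_left h, averageAt_apply_right h,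
    sumSq]
  ring

end Weights

/-! ### Backward weights of a list of rings, and the edges near their support -/

namespace SimpleGraph

variable {V : Type*} (G : SimpleGraph V)

/-- An endpoint of the edge `e`. -/
noncomputable def endA (e : G.edgeSet) : V := (Quot.out e.1).1

/-- The endpoint of the edge `e` other than `G.endA e`. -/
noncomputable def endB (e : G.edgeSet) : V := (Quot.out e.1).2

lemma mk_ends (e : G.edgeSet) : e.1 = s(G.endA e, G.endB e) := (Quot.out_eq e.1).symm

lemma adj_ends (e : G.edgeSet) : G.Adj (G.endA e) (G.endB e) := by
  rw [← G.mem_edgeSet, ← G.mk_ends]; exact e.2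

/-- The weights on the initial opinions that result when, going back in time, the edges of the
list `l` ring (the last entry of `l` rings last), starting from the unit mass at `o`. -/
noncomputable def weight (o : V) : List G.edgeSet → V →₀ ℝ
  | [] => Finsupp.single o 1
  | e :: l => averageAt (G.endA e) (G.endB e) (weight o l)

lemma weight_nonneg (o : V) (l : List G.edgeSet) (v : V) : 0 ≤ G.weight o l v := by
  induction l generalizing v with
  | nil => classical rw [weight, Finsupp.single_apply]; split_ifs <;> norm_num
  | cons e l ih => exact averageAt_nonneg (G.adj_ends e).ne ih v

lemma linearCombination_one_weight (o : V) (l : List G.edgeSet) :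
    Finsupp.linearCombination ℝ (fun _ => (1 : ℝ)) (G.weight o l) = 1 := by
  induction l with
  | nil => simp [weight]
  | cons e l ih => rw [weight, linearCombination_averageAt, ih]; simp

lemma sum_weight (o : V) (l : List G.edgeSet) :
    ∑ v ∈ (G.weight o l).support, G.weight o l v = 1 := by
  rw [← G.linearCombination_one_weight o l, linearCombination_eq_sum]; simp

/-- If both endpoints carry no mass, averaging changes nothing; otherwise one of them is already in
the support, and only the other can be new. -/
lemma card_support_weight_le (o : V) (l : List G.edgeSet) :
    (G.weight o l).support.card ≤ l.length + 1 := by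
  classical
  induction l with
  | nil => exact (Finset.card_le_card Finsupp.support_single_subset).trans (by simp)
  | cons e l ih =>
    have hne := (G.adj_ends e).ne
    set w := G.weight o l with hw
    have hwe : G.weight o (e :: l) = averageAt (G.endA e) (G.endB e) w := rfl
    have hz : ∀ z, z ≠ G.endA e → z ≠ G.endB e → averageAt (G.endA e) (G.endB e) w z = w z :=
      fun z h1 h2 => averageAt_apply_of_ne h1 h2 w
    have : ∃ z, (G.weight o (e :: l)).support ⊆ insert z w.support := by
      rw [hwe]
      by_cases hA : w (G.endA e) = 0
      · by_cases hB : w (G.endB e) = 0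
        · refine ⟨G.endA e, fun z hzs => ?_⟩
          rw [averageAt, hA, hB] at hzs
          simp at hzs
          simp [hzs]
        · refine ⟨G.endA e, fun z hzs => ?_⟩
          by_cases h1 : z = G.endA e
          · simp [h1]
          by_cases h2 : z = G.endB e
          · simp [h2, hB]
          rw [Finsupp.mem_support_iff, hz z h1 h2] at hzs
          simp [hzs]
      · refine ⟨G.endB e, fun z hzs => ?_⟩
        by_cases h1 : z = G.endA e
        · simp [h1, hA]
        by_cases h2 : z = G.endB e
        · simp [h2]
        rw [Finsupp.mem_support_iff, hz z h1 h2] at hzs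
        simp [hzs]
    obtain ⟨z, hz⟩ := this
    exact (Finset.card_le_card hz).trans ((Finset.card_insert_le _ _).trans
      (by simpa using ih))

/-- The edges at `v`. -/
noncomputable def edgesAt [G.LocallyFinite] (v : V) : Finset G.edgeSet := by
  classical
  exact (G.neighborFinset v).attach.image
    fun u => ⟨s(v, u.1), G.mem_edgeSet.2 ((G.mem_neighborFinset v u.1).1 u.2)⟩

lemma mem_edgesAt [G.LocallyFinite] {v : V} {e : G.edgeSet} : e ∈ G.edgesAt v ↔ v ∈ e.1 := by
  classical
  simp only [edgesAt, Finset.mem_image, Finset.mem_attach, true_and, Subtype.exists]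
  constructor
  · rintro ⟨u, hu, rfl⟩
    exact Sym2.mem_mk_left _ _
  · intro h
    obtain ⟨u, hu⟩ := Sym2.mem_iff_exists.1 h
    have : G.Adj v u := by rw [← G.mem_edgeSet, ← hu]; exact e.2
    exact ⟨u, (G.mem_neighborFinset v u).2 this, Subtype.ext hu.symm⟩

/-- The edges which meet the support of the weights, or a neighbor of the support. -/
noncomputable def nearEdges [G.LocallyFinite] (o : V) (l : List G.edgeSet) : Finset G.edgeSet := by
  classical
  exact (G.weight o l).support.biUnion
    fun v => (insert v (G.neighborFinset v)).biUnion G.edgesAt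

lemma mem_nearEdges [G.LocallyFinite] {o : V} {l : List G.edgeSet} {e : G.edgeSet} :
    e ∈ G.nearEdges o l ↔
      ∃ v, G.weight o l v ≠ 0 ∧ ∃ u, (u = v ∨ G.Adj v u) ∧ u ∈ e.1 := by
  classical
  simp [nearEdges, mem_edgesAt]

lemma card_nearEdges_le [G.LocallyFinite] {Δ : ℕ} (hΔ : ∀ v, G.degree v ≤ Δ) (o : V)
    (l : List G.edgeSet) : (G.nearEdges o l).card ≤ (l.length + 1) * ((Δ + 1) * Δ) := by
  classical
  refine (Finset.card_biUnion_le_card_mul _ _ ((Δ + 1) * Δ) fun v _ => ?_).trans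
    (Nat.mul_le_mul_right _ (G.card_support_weight_le o l))
  refine (Finset.card_biUnion_le_card_mul _ _ Δ fun u _ => ?_).trans
    (Nat.mul_le_mul_right _ ?_)
  · refine Finset.card_image_le.trans ?_
    rw [Finset.card_attach]; exact hΔ u
  · exact (Finset.card_insert_le _ _).trans (Nat.succ_le_succ (hΔ v))

end SimpleGraph

/-! ### Duality between opinions and weights over one time window -/

namespace FollowsEdgeAveraging

variable {V : Type*} {G : SimpleGraph V} {n : G.edgeSet → ℝ≥0 → ℕ} {x : ℝ≥0 → V → ℝ}
  [G.LocallyFinite]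

lemma linearCombination_eq_of_silent (hx : FollowsEdgeAveraging G n x) (hm : ∀ e, Monotone (n e))
    {a b : ℝ≥0} (hab : a ≤ b) {o : V} {l : List G.edgeSet}
    (h : ∀ e ∈ G.nearEdges o l, n e b = n e a) :
    Finsupp.linearCombination ℝ (x b) (G.weight o l) =
      Finsupp.linearCombination ℝ (x a) (G.weight o l) := by
  rw [linearCombination_eq_sum, linearCombination_eq_sum]
  refine Finset.sum_congr rfl fun v hv => ?_
  rw [hx.eq_of_silent hm hab fun e he => h e ?_]
  exact G.mem_nearEdges.2 ⟨v, Finsupp.mem_support_iff.1 hv, v, Or.inl rfl, he⟩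

/-- Averaging over an edge is a symmetric operator, so it can be moved from the opinions to the
weights. -/
lemma linearCombination_eq_of_single_ring (hx : FollowsEdgeAveraging G n x)
    (hm : ∀ e, Monotone (n e)) (hc : ∀ e t, ContinuousWithinAt (n e) (Ici t) t)
    {a b : ℝ≥0} (hab : a ≤ b) {o : V} {l : List G.edgeSet} {e : G.edgeSet}
    (he : n e b = n e a + 1)
    (h : ∀ e' ∈ G.nearEdges o l, e' ≠ e → n e' b = n e' a) :
    Finsupp.linearCombination ℝ (x b) (G.weight o l) =
      Finsupp.linearCombination ℝ (x a) (G.weight o (e :: l)) := by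
  classical
  rw [SimpleGraph.weight, linearCombination_averageAt]
  set w := G.weight o l with hw
  set u := G.endA e with hu
  set v := G.endB e with hv
  have huv : G.Adj u v := G.adj_ends e
  have hev : e.1 = s(u, v) := G.mk_ends e
  have hfar : ∀ z ∈ w.support, z ≠ u → z ≠ v → x b z = x a z := by
    intro z hz hzu hzv
    refine hx.eq_of_silent hm hab fun e' he' => h e' ?_ ?_
    · exact G.mem_nearEdges.2 ⟨z, Finsupp.mem_support_iff.1 hz, z, Or.inl rfl, he'⟩
    · rintro rfl
      rw [hev, Sym2.mem_iff] at he'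
      tauto
  have hsplit : ∀ y : V → ℝ, Finsupp.linearCombination ℝ y w =
      w u * y u + w v * y v + ∑ z ∈ (w.support.erase u).erase v, w z * y z := by
    intro y
    have h1 : Finsupp.linearCombination ℝ y w =
        ∑ z ∈ insert u (insert v ((w.support.erase u).erase v)), w z * y z := by
      rw [linearCombination_eq_sum]
      refine Finset.sum_subset (fun z hz => ?_) fun z _ hz => ?_
      · by_cases h1 : z = u
        · simp [h1]
        by_cases h2 : z = v
        · simp [h2]
        simp [h1, h2, Finsupp.mem_support_iff.1 hz]
      · rw [Finsupp.notMem_support_iff.1 hz, zero_mul]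
    rw [h1, Finset.sum_insert, Finset.sum_insert, ← add_assoc]
    · simp
    · simp [huv.ne]
  have hrest : ∑ z ∈ (w.support.erase u).erase v, w z * x b z =
      ∑ z ∈ (w.support.erase u).erase v, w z * x a z := by
    refine Finset.sum_congr rfl fun z hz => ?_
    simp only [Finset.mem_erase] at hz
    rw [hfar z hz.2.2 hz.2.1 hz.1]
  rw [hsplit (x b), hsplit (x a), hrest]
  -- Without mass at `u` and `v`, their opinions are not read. Otherwise one endpoint is in the
  -- support and the other is its neighbor; this is why `nearEdges` includes the edges at neighbors
  -- of the support.
  by_cases h0 : w u = 0 ∧ w v = 0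
  · rw [h0.1, h0.2]; ring
  · have hnear : ∀ e' : G.edgeSet, (u ∈ e'.1 ∨ v ∈ e'.1) → e' ≠ e → n e' b = n e' a := by
      intro e' he' hne
      refine h e' (G.mem_nearEdges.2 ?_) hne
      by_cases h1 : w u = 0
      · have h2 : w v ≠ 0 := fun h2 => h0 ⟨h1, h2⟩
        rcases he' with he' | he'
        · exact ⟨v, h2, u, Or.inr huv.symm, he'⟩
        · exact ⟨v, h2, v, Or.inl rfl, he'⟩
      · rcases he' with he' | he'
        · exact ⟨u, h1, u, Or.inl rfl, he'⟩
        · exact ⟨u, h1, v, Or.inr huv, he'⟩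
    obtain ⟨h1, h2⟩ := hx.eq_average hm hc huv e hev he hnear
    rw [h1, h2]; ring

end FollowsEdgeAveraging

/-! ### The history of rings near a growing set, seen at discrete times -/

section History

open scoped ENNReal

variable {E : Type*} (F : List E → Finset E)

/-- `e` is the only element of `F l` counted by `n`, and it is counted once. -/
def IsSingleRing (l : List E) (n : E → ℕ) (e : E) : Prop :=
  e ∈ F l ∧ n e = 1 ∧ ∀ e' ∈ F l, e' ≠ e → n e' = 0

open Classical in
/-- Update of a history `l` by counts `n`: a single ring in `F l` is recorded, and more than one
ring in `F l` leads to the failure state `none`. -/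
noncomputable def historyStep : Option (List E) → (E → ℕ) → Option (List E)
  | none, _ => none
  | some l, n =>
    if ∀ e ∈ F l, n e = 0 then some l
    else if h : ∃ e, IsSingleRing F l n e then some (h.choose :: l) else none

variable {F}

lemma IsSingleRing.eq {l : List E} {n : E → ℕ} {e e' : E} (h : IsSingleRing F l n e)
    (h' : IsSingleRing F l n e') : e = e' := by
  by_contra hne
  have := h'.2.2 e h.1 hne
  have := h.2.1
  omega

lemma historyStep_of_silent {l : List E} {n : E → ℕ} (h : ∀ e ∈ F l, n e = 0) :
    historyStep F (some l) n = some l := by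
  rw [historyStep, if_pos h]

lemma historyStep_of_isSingleRing {l : List E} {n : E → ℕ} {e : E} (h : IsSingleRing F l n e) :
    historyStep F (some l) n = some (e :: l) := by
  have hex : ∃ e, IsSingleRing F l n e := ⟨e, h⟩
  rw [historyStep, if_neg, dif_pos hex, hex.choose_spec.eq h]
  intro h0
  have := h0 e h.1
  have := h.2.1
  omega

lemma historyStep_of_not {l : List E} {n : E → ℕ} (h0 : ¬ ∀ e ∈ F l, n e = 0)
    (h1 : ¬ ∃ e, IsSingleRing F l n e) : historyStep F (some l) n = none := by
  rw [historyStep, if_neg h0, dif_neg h1]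

lemma historyStep_congr {l : List E} {n n' : E → ℕ} (h : ∀ e ∈ F l, n e = n' e) :
    historyStep F (some l) n = historyStep F (some l) n' := by
  by_cases h0 : ∀ e ∈ F l, n e = 0
  · rw [historyStep_of_silent h0, historyStep_of_silent fun e he => (h e he).symm.trans (h0 e he)]
  have h0' : ¬ ∀ e ∈ F l, n' e = 0 := fun h' => h0 fun e he => (h e he).trans (h' e he)
  by_cases h1 : ∃ e, IsSingleRing F l n e
  · obtain ⟨e, he⟩ := h1
    rw [historyStep_of_isSingleRing he, historyStep_of_isSingleRing (e := e)]
    exact ⟨he.1, (h e he.1).symm.trans he.2.1,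
      fun e' h' hne => (h e' h').symm.trans (he.2.2 e' h' hne)⟩
  · rw [historyStep_of_not h0 h1, historyStep_of_not h0']
    rintro ⟨e, he⟩
    exact h1 ⟨e, he.1, (h e he.1).trans he.2.1,
      fun e' h' hne => (h e' h').trans (he.2.2 e' h' hne)⟩

variable (F) in
-- Only the finitely many counts in `F l` matter, and every subset of a finite product of copies of
-- ℕ is measurable.
lemma measurableSet_historyStep_eq (s s' : Option (List E)) :
    MeasurableSet {n : E → ℕ | historyStep F s n = s'} := by
  classical
  cases s with
  | none => simp [historyStep]
  | some l =>
    have : {n : E → ℕ | historyStep F (some l) n = s'} =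
        (fun (n : E → ℕ) (e : F l) => n e) ⁻¹' {m | historyStep F (some l)
          (fun e => if h : e ∈ F l then m ⟨e, h⟩ else 0) = s'} := by
      ext n
      simp only [mem_ofPred_eq, mem_preimage]
      rw [historyStep_congr]
      intro e he
      rw [dif_pos he]
    rw [this]
    exact (measurable_pi_lambda _ fun e => measurable_pi_apply _) (MeasurableSet.of_discrete)

variable (F) in
/-- The history after `k` updates by the counts `Y 0, Y 1, …`, starting from the empty history. -/
noncomputable def historyChain (Y : ℕ → E → ℕ) : ℕ → Option (List E)
  | 0 => some []
  | k + 1 => historyStep F (historyChain Y k) (Y k)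

variable {Ω : Type*}

variable (F) in
-- The σ-algebra is left free so that it can be the one of the counts before step `k` (Markov
-- property) or the one of all clocks (independence from the initial opinions).
lemma measurableSet_historyChain_eq [Countable E] (m : MeasurableSpace Ω) (ξ : E × ℕ → Ω → ℕ)
    (k : ℕ) (hξ : ∀ e, ∀ i < k, Measurable[m] (ξ (e, i))) (s : Option (List E)) :
    MeasurableSet[m] {ω | historyChain F (fun i e => ξ (e, i) ω) k = s} := by
  induction k generalizing s with
  | zero => simp [historyChain]
  | succ k ih =>
    have : {ω | historyChain F (fun i e => ξ (e, i) ω) (k + 1) = s} =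
        ⋃ s', {ω | historyChain F (fun i e => ξ (e, i) ω) k = s'} ∩
          {ω | historyStep F s' (fun e => ξ (e, k) ω) = s} := by
      ext ω
      simp [historyChain]
    rw [this]
    refine MeasurableSet.iUnion fun s' => (ih (fun e i hi => hξ e i (by omega)) s').inter ?_
    exact (measurable_pi_lambda _ fun e => hξ e k (Nat.lt_succ_self k))
      (measurableSet_historyStep_eq F s' s)

lemma lintegral_eq_tsum_of_countable [MeasurableSpace Ω] {P : Measure Ω} {S : Type*} [Countable S]
    (X : Ω → S) (hX : ∀ s, MeasurableSet {ω | X ω = s}) (g : S → Ω → ℝ≥0∞)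
    (hg : ∀ s, Measurable (g s)) :
    ∫⁻ ω, g (X ω) ω ∂P = ∑' s, ∫⁻ ω, {ω | X ω = s}.indicator 1 ω * g s ω ∂P := by
  rw [← lintegral_tsum (f := fun s ω => {ω | X ω = s}.indicator 1 ω * g s ω) fun s =>
    ((measurable_one.indicator (hX s)).mul (hg s)).aemeasurable]
  refine lintegral_congr fun ω => ?_
  rw [tsum_eq_single (X ω) fun s hs => by simp [Ne.symm hs]]
  simp

lemma measurable_indicator_one [MeasurableSpace Ω] {T : Set Ω} (hT : MeasurableSet T) :
    Measurable (T.indicator (1 : Ω → ℝ≥0∞)) := measurable_one.indicator hT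

/-- Markov property: the state after `k` steps uses counts of index below `k`, which are independent
of those of index `k`. Summing over the countably many states, each step costs a factor `c`. -/
lemma lintegral_historyChain_le [Countable E] [MeasurableSpace Ω] {P : Measure Ω}
    [IsProbabilityMeasure P] {ξ : E × ℕ → Ω → ℕ} (hξ : ∀ p, Measurable (ξ p)) (hi : iIndepFun ξ P)
    (Ψ : Option (List E) → ℝ≥0∞) (c : ℝ≥0∞)
    (h : ∀ s k, ∫⁻ ω, Ψ (historyStep F s fun e => ξ (e, k) ω) ∂P ≤ c * Ψ s) (k : ℕ) :
    ∫⁻ ω, Ψ (historyChain F (fun i e => ξ (e, i) ω) k) ∂P ≤ c ^ k * Ψ (some []) := by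
  induction k with
  | zero => simp [historyChain]
  | succ k ih =>
    have hS : ∀ s, MeasurableSet {ω | historyChain F (fun i e => ξ (e, i) ω) k = s} :=
      measurableSet_historyChain_eq F _ ξ k fun e i _ => hξ _
    have hstep : ∀ (m : MeasurableSpace Ω), (∀ e, Measurable[m] (ξ (e, k))) → ∀ s,
        Measurable[m] fun ω => Ψ (historyStep F s fun e => ξ (e, k) ω) := by
      intro m hm s
      let _ : MeasurableSpace (Option (List E)) := ⊤
      have h1 : Measurable[m] fun ω => historyStep F s fun e => ξ (e, k) ω :=
        measurable_to_countable' fun s' =>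
          (measurable_pi_lambda _ hm) (measurableSet_historyStep_eq F s s')
      exact (measurable_from_top (f := Ψ)).comp h1
    have hind : ∀ s, ∫⁻ ω, {ω | historyChain F (fun i e => ξ (e, i) ω) k = s}.indicator 1 ω *
        Ψ (historyStep F s fun e => ξ (e, k) ω) ∂P =
        P {ω | historyChain F (fun i e => ξ (e, i) ω) k = s} *
          ∫⁻ ω, Ψ (historyStep F s fun e => ξ (e, k) ω) ∂P := by
      intro s
      have hdisj : Disjoint {p : E × ℕ | p.2 < k} {p : E × ℕ | p.2 = k} :=
        Set.disjoint_left.2 fun p h1 h2 => (ne_of_lt h1) h2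
      have hI := indep_iSup_of_disjoint (fun p => (hξ p).comap_le) hi.iIndep hdisj
      have hle : ∀ T : Set (E × ℕ),
          ⨆ p ∈ T, MeasurableSpace.comap (ξ p) inferInstance ≤ (inferInstance : MeasurableSpace Ω) :=
        fun T => iSup₂_le fun p _ => (hξ p).comap_le
      have hm : ∀ (T : Set (E × ℕ)) p, p ∈ T →
          Measurable[⨆ p ∈ T, MeasurableSpace.comap (ξ p) inferInstance] (ξ p) := fun T p hp =>
        measurable_iff_comap_le.2 (le_iSup₂_of_le p hp le_rfl)
      rw [lintegral_mul_eq_lintegral_mul_lintegral_of_independent_measurableSpace (hle _) (hle _) hI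
        (@measurable_indicator_one _ (_) _ (measurableSet_historyChain_eq F _ ξ k
          (fun e i hi => hm _ (e, i) hi) s)) (hstep _ (fun e => hm _ (e, k) rfl) s),
        lintegral_indicator_one (hS s)]
    calc ∫⁻ ω, Ψ (historyChain F (fun i e => ξ (e, i) ω) (k + 1)) ∂P
        = ∑' s, P {ω | historyChain F (fun i e => ξ (e, i) ω) k = s} *
          ∫⁻ ω, Ψ (historyStep F s fun e => ξ (e, k) ω) ∂P := by
          simp_rw [← hind]
          exact lintegral_eq_tsum_of_countable _ hS
            (fun s ω => Ψ (historyStep F s fun e => ξ (e, k) ω)) (hstep _ fun e => hξ _)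
      _ ≤ ∑' s, c * (P {ω | historyChain F (fun i e => ξ (e, i) ω) k = s} * Ψ s) := by
          refine ENNReal.tsum_le_tsum fun s => ?_
          calc _ ≤ P {ω | historyChain F (fun i e => ξ (e, i) ω) k = s} * (c * Ψ s) := by
                gcongr; exact h s k
            _ = _ := by ring
      _ = c * ∫⁻ ω, Ψ (historyChain F (fun i e => ξ (e, i) ω) k) ∂P := by
          rw [ENNReal.tsum_mul_left, lintegral_eq_tsum_of_countable _ hS (fun s _ => Ψ s)
            fun _ => measurable_const]
          congr 2
          ext s
          rw [lintegral_mul_const _ (measurable_one.indicator (hS s)),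
            lintegral_indicator_one (hS s)]
      _ ≤ c ^ (k + 1) * Ψ (some []) := by
          calc _ ≤ c * (c ^ k * Ψ (some [])) := by gcongr
            _ = _ := by ring

/-! ### One step with Poisson counts -/

section OneStep

variable [MeasurableSpace Ω] {P : Measure Ω} {ξ : E → Ω → ℕ} {h : ℝ≥0}

lemma measure_forall_eq (hi : iIndepFun ξ P) (hlaw : ∀ e, HasLaw (ξ e) (poissonMeasure h) P)
    (A : Finset E) (k : E → ℕ) :
    P {ω | ∀ e ∈ A, ξ e ω = k e} =
      ∏ e ∈ A, ENNReal.ofReal (Real.exp (-h) * h ^ k e / (k e).factorial) := by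
  have h1 := hi.measure_inter_preimage_eq_mul A (sets := fun e => {k e})
    fun e _ => measurableSet_singleton _
  have h2 : {ω | ∀ e ∈ A, ξ e ω = k e} = ⋂ i ∈ A, ξ i ⁻¹' {k i} := by ext; simp
  rw [h2, h1]
  refine Finset.prod_congr rfl fun e _ => ?_
  rw [← poissonMeasure_singleton, ← (hlaw e).map_eq,
    Measure.map_apply_of_aemeasurable (hlaw e).aemeasurable (measurableSet_singleton _)]

lemma measure_silent (hi : iIndepFun ξ P) (hlaw : ∀ e, HasLaw (ξ e) (poissonMeasure h) P)
    (A : Finset E) :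
    P {ω | ∀ e ∈ A, ξ e ω = 0} = ENNReal.ofReal (Real.exp (-(h * A.card))) := by
  rw [measure_forall_eq hi hlaw A (fun _ => 0)]
  simp only [pow_zero, mul_one, Nat.factorial_zero, Nat.cast_one, div_one, Finset.prod_const]
  rw [← ENNReal.ofReal_pow (Real.exp_nonneg _), ← Real.exp_nat_mul]
  congr 2; ring

lemma measure_isSingleRing (hi : iIndepFun ξ P) (hlaw : ∀ e, HasLaw (ξ e) (poissonMeasure h) P)
    {l : List E} {e : E} (he : e ∈ F l) :
    P {ω | IsSingleRing F l (fun e => ξ e ω) e} =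
      ENNReal.ofReal (h * Real.exp (-(h * (F l).card))) := by
  classical
  have h1 : {ω | IsSingleRing F l (fun e => ξ e ω) e} =
      {ω | ∀ e' ∈ F l, ξ e' ω = if e' = e then 1 else 0} := by
    ext ω
    simp only [IsSingleRing, mem_ofPred_eq]
    constructor
    · rintro ⟨-, h1, h2⟩ e' he'
      split_ifs with hee
      · rw [hee, h1]
      · exact h2 e' he' hee
    · intro h'
      exact ⟨he, by simpa using h' e he, fun e' he' hne => by simpa [hne] using h' e' he'⟩
  rw [h1, measure_forall_eq hi hlaw (F l) fun e' => if e' = e then 1 else 0,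
    ← ENNReal.ofReal_prod_of_nonneg fun _ _ => by positivity]
  congr 1
  have h2 : ∀ e' ∈ F l, Real.exp (-h) * (h : ℝ) ^ (if e' = e then 1 else 0) /
      ((if e' = e then 1 else 0 : ℕ).factorial : ℝ) =
      Real.exp (-h) * (if e' = e then (h : ℝ) else 1) := by
    intro e' _
    split_ifs <;> simp
  rw [Finset.prod_congr rfl h2, Finset.prod_mul_distrib, Finset.prod_ite_eq' , if_pos he,
    Finset.prod_const, ← Real.exp_nat_mul, mul_comm]
  congr 2; ring

/-- The left side is the probability that a Poisson variable of mean `x` is at least 2. -/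
lemma one_sub_exp_mul_le (x : ℝ) (hx : 0 ≤ x) : 1 - Real.exp (-x) * (1 + x) ≤ x ^ 2 := by
  have := Real.add_one_le_exp (-x)
  nlinarith

/-- Split according to no ring in `F l`, a single ring at a given edge, or at least two rings; the
last event has probability at most the square of the mean total count. -/
lemma lintegral_historyStep_le [IsProbabilityMeasure P] (hξ : ∀ e, Measurable (ξ e)) (hi : iIndepFun ξ P)
    (hlaw : ∀ e, HasLaw (ξ e) (poissonMeasure h) P) (ψ : Option (List E) → ℝ) (hψ : ∀ s, 0 ≤ ψ s)
    (l : List E) :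
    ∫⁻ ω, ENNReal.ofReal (ψ (historyStep F (some l) fun e => ξ e ω)) ∂P ≤
      ENNReal.ofReal (Real.exp (-(h * (F l).card)) * (ψ (some l) + h * ∑ e ∈ F l, ψ (some (e :: l)))
        + (h * (F l).card) ^ 2 * ψ none) := by
  classical
  set L : ℝ := Nat.cast (F l).card with hL
  set A0 : Set Ω := {ω | ∀ e ∈ F l, ξ e ω = 0} with hA0
  set A : E → Set Ω := fun e => {ω | IsSingleRing F l (fun e => ξ e ω) e} with hA
  have hmξ : Measurable fun ω e => ξ e ω := measurable_pi_lambda _ hξ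
  have mA0 : MeasurableSet A0 := by
    have : A0 = ⋂ e ∈ F l, ξ e ⁻¹' {0} := by ext; simp [hA0]
    rw [this]
    exact Finset.measurableSet_biInter _ fun e _ => hξ e (measurableSet_singleton _)
  have mA : ∀ e, MeasurableSet (A e) := by
    intro e
    have : A e = (fun ω e => ξ e ω) ⁻¹' {n | historyStep F (some l) n = some (e :: l)} := by
      ext ω
      simp only [hA, mem_ofPred_eq, mem_preimage]
      refine ⟨fun h => historyStep_of_isSingleRing h, fun h' => ?_⟩
      by_cases h0 : ∀ e ∈ F l, ξ e ω = 0
      · rw [historyStep_of_silent h0] at h'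
        simp at h'
      by_cases h1 : ∃ e, IsSingleRing F l (fun e => ξ e ω) e
      · obtain ⟨e', he'⟩ := h1
        rw [historyStep_of_isSingleRing he'] at h'
        simp only [Option.some.injEq, List.cons.injEq, and_true] at h'
        rwa [← h']
      · rw [historyStep_of_not h0 h1] at h'
        simp at h'
    rw [this]
    exact hmξ (measurableSet_historyStep_eq F _ _)
  have dA : PairwiseDisjoint (F l : Set E) A := fun e _ e' _ hne =>
    Set.disjoint_left.2 fun ω h1 h2 => hne <| by
      simp only [hA, mem_ofPred_eq] at h1 h2
      exact h1.eq h2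
  have d0 : Disjoint A0 (⋃ e ∈ F l, A e) := by
    refine Set.disjoint_left.2 fun ω h1 h2 => ?_
    simp only [mem_iUnion] at h2
    obtain ⟨e, he, h2⟩ := h2
    simp only [hA0, hA, mem_ofPred_eq] at h1 h2
    have h3 : ξ e ω = 0 := h1 e he
    have h4 : ξ e ω = 1 := h2.2.1
    omega
  have mU : MeasurableSet (A0 ∪ ⋃ e ∈ F l, A e) :=
    mA0.union (Finset.measurableSet_biUnion _ fun e _ => mA e)
  have pA0 : P A0 = ENNReal.ofReal (Real.exp (-(h * L))) := measure_silent hi hlaw _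
  have pA : ∀ e ∈ F l, P (A e) = ENNReal.ofReal (h * Real.exp (-(h * L))) := fun e he =>
    measure_isSingleRing hi hlaw he
  have pU : P (A0 ∪ ⋃ e ∈ F l, A e)ᶜ ≤ ENNReal.ofReal ((h * L) ^ 2) := by
    rw [prob_compl_eq_one_sub mU, measure_union d0 (Finset.measurableSet_biUnion _ fun e _ => mA e),
      measure_biUnion_finset dA fun e _ => mA e, pA0, Finset.sum_congr rfl pA, Finset.sum_const,
      nsmul_eq_mul, ← ENNReal.ofReal_natCast, ← ENNReal.ofReal_mul (by positivity),
      ← ENNReal.ofReal_add (by positivity) (by positivity), ← ENNReal.ofReal_one,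
      ← ENNReal.ofReal_sub _ (by positivity)]
    refine ENNReal.ofReal_le_ofReal ?_
    have := one_sub_exp_mul_le (h * L) (by positivity)
    linarith
  have hpt : ∀ ω, ENNReal.ofReal (ψ (historyStep F (some l) fun e => ξ e ω)) ≤
      A0.indicator (fun _ => ENNReal.ofReal (ψ (some l))) ω +
      ∑ e ∈ F l, (A e).indicator (fun _ => ENNReal.ofReal (ψ (some (e :: l)))) ω +
      (A0 ∪ ⋃ e ∈ F l, A e)ᶜ.indicator (fun _ => ENNReal.ofReal (ψ none)) ω := by
    intro ω
    by_cases h0 : ω ∈ A0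
    · rw [historyStep_of_silent h0, indicator_of_mem h0, add_assoc]
      exact le_self_add
    by_cases h1 : ∃ e, IsSingleRing F l (fun e => ξ e ω) e
    · obtain ⟨e, he⟩ := h1
      have hm : ω ∈ A e := he
      rw [historyStep_of_isSingleRing he]
      refine le_trans ?_ le_self_add
      refine le_trans ?_ le_add_self
      refine le_trans ?_ (Finset.single_le_sum
        (f := fun e => (A e).indicator (fun _ => ENNReal.ofReal (ψ (some (e :: l)))) ω)
        (fun _ _ => zero_le) he.1)
      simp [hm]
    · rw [historyStep_of_not h0 h1]
      have hm : ω ∈ (A0 ∪ ⋃ e ∈ F l, A e)ᶜ := by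
        simp only [mem_compl_iff, mem_union, mem_iUnion, not_or, not_exists]
        exact ⟨h0, fun e he hAe => h1 ⟨e, hAe⟩⟩
      rw [indicator_of_mem hm]
      exact le_add_self
  refine (lintegral_mono hpt).trans ?_
  rw [lintegral_add_right _ (measurable_const.indicator mU.compl),
    lintegral_add_left (measurable_const.indicator mA0),
    lintegral_finsetSum _ fun e _ => measurable_const.indicator (mA e),
    lintegral_indicator_const mA0, lintegral_indicator_const mU.compl, pA0,
    Finset.sum_congr rfl fun e he => (lintegral_indicator_const (mA e) _).trans (by rw [pA e he])]
  rw [← ENNReal.ofReal_mul (hψ _),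
    Finset.sum_congr rfl fun e _ => (ENNReal.ofReal_mul (hψ _)).symm,
    ← ENNReal.ofReal_sum_of_nonneg fun e _ => mul_nonneg (hψ _) (by positivity),
    ← ENNReal.ofReal_add (mul_nonneg (hψ _) (by positivity))
      (Finset.sum_nonneg fun e _ => mul_nonneg (hψ _) (by positivity)),
    ENNReal.ofReal_add (p := _ * _) (q := _ * _)]
  · refine add_le_add (ENNReal.ofReal_le_ofReal (le_of_eq ?_)) ?_
    · rw [← Finset.sum_mul]; ring
    · rw [mul_comm, ENNReal.ofReal_mul (by positivity)]
      gcongr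
  · exact mul_nonneg (by positivity) (add_nonneg (hψ _) (mul_nonneg (by positivity)
      (Finset.sum_nonneg fun e _ => hψ _)))
  · exact mul_nonneg (by positivity) (hψ _)

end OneStep

end History

/-! ### Decay of the sum of squares -/

section Energy

/-- `exp (-1 / Q)` for `Q > q`, and `0` otherwise. -/
noncomputable def truncExp (q Q : ℝ) : ℝ := if q < Q then Real.exp (-1 / Q) else 0

lemma truncExp_nonneg (q Q : ℝ) : 0 ≤ truncExp q Q := by
  unfold truncExp; split_ifs <;> positivity

/-- With x = δ/Q², 1/(Q - δ) ≥ 1/Q + x while Q - δ > q, and exp(-x) ≤ 1/(1 + x) = 1 - x/(1 + x).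
Past the threshold the left side is 0. -/
lemma truncExp_sub_le {q Q δ : ℝ} (hq : 0 ≤ q) (hQ : q < Q) (hδ : 0 ≤ δ) :
    truncExp q (Q - δ) ≤ truncExp q Q * (1 - δ / Q ^ 2 / (1 + δ / Q ^ 2)) := by
  have hQ0 : 0 < Q := hq.trans_lt hQ
  set x := δ / Q ^ 2 with hx
  have hx0 : 0 ≤ x := by positivity
  have h1 : 1 - x / (1 + x) = (1 + x)⁻¹ := by field_simp; ring
  rw [h1, truncExp, truncExp, if_pos hQ]
  split_ifs with h
  · have hQ' : 0 < Q - δ := hq.trans_lt h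
    have h2 : -1 / (Q - δ) ≤ -1 / Q + -x := by
      have h3 : 1 / (Q - δ) - (1 / Q + x) = δ ^ 2 / ((Q - δ) * Q ^ 2) := by
        rw [hx]; field_simp; ring
      have h4 : 0 ≤ δ ^ 2 / ((Q - δ) * Q ^ 2) := by positivity
      rw [neg_div, neg_div]
      linarith
    calc Real.exp (-1 / (Q - δ)) ≤ Real.exp (-1 / Q + -x) := Real.exp_le_exp.2 h2
      _ = Real.exp (-1 / Q) * (Real.exp x)⁻¹ := by rw [Real.exp_add, Real.exp_neg x]
      _ ≤ _ := by
        gcongr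
        linarith [Real.add_one_le_exp x]
  · positivity

lemma div_one_add_sum_le {ι : Type*} (s : Finset ι) {x : ι → ℝ} (hx : ∀ i, 0 ≤ x i) :
    (∑ i ∈ s, x i) / (1 + ∑ i ∈ s, x i) ≤ ∑ i ∈ s, x i / (1 + x i) := by
  rw [Finset.sum_div]
  refine Finset.sum_le_sum fun i hi => ?_
  have := Finset.single_le_sum (f := x) (fun j _ => hx j) hi
  have := hx i
  gcongr

namespace SimpleGraph

variable {V : Type*} {G : SimpleGraph V}

/-- Cut a simple path from `a` to `z` at its first vertex of value at most `c`. -/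
lemma Connected.exists_descending_path (hG : G.Connected) {w : V → ℝ} {c : ℝ} {a z : V}
    (ha : c < w a) (hz : w z ≤ c) :
    ∃ (k : ℕ) (x : ℕ → V), 0 < k ∧ x 0 = a ∧ (∀ i < k, G.Adj (x i) (x (i + 1))) ∧
      InjOn x {i | i ≤ k} ∧ (∀ i < k, c < w (x i)) ∧ w (x k) ≤ c := by
  classical
  obtain ⟨p, hp⟩ := hG.exists_isPath a z
  have hex : ∃ i, w (p.getVert i) ≤ c := ⟨p.length, by simpa using hz⟩
  have hk : Nat.find hex ≤ p.length := Nat.find_min' hex (by simpa using hz)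
  refine ⟨Nat.find hex, p.getVert, ?_, by simp, fun i hi => p.adj_getVert_succ (by omega),
    hp.getVert_injOn.mono fun i (hi : i ≤ _) => hi.trans hk, fun i hi => ?_, Nat.find_spec hex⟩
  · rw [Nat.find_pos]
    simpa using ha
  · exact not_le.1 (Nat.find_min hex hi)

lemma sq_ends_sub {e : G.edgeSet} {u v : V} (he : e.1 = s(u, v)) (w : V → ℝ) :
    (w (G.endA e) - w (G.endB e)) ^ 2 = (w u - w v) ^ 2 := by
  have := G.mk_ends e
  rw [he, Sym2.eq_iff] at this
  rcases this with ⟨h1, h2⟩ | ⟨h1, h2⟩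
  · rw [h1, h2]
  · rw [h1, h2]; ring

/-- If the largest weight is `M`, and some weight is at most `M / 2`, then the differences of the
weights along some path are bounded below. -/
lemma exists_edges_sum_sq_ge [G.LocallyFinite] (hG : G.Connected) (o : V) (l : List G.edgeSet) {a z : V}
    (ha : 0 < G.weight o l a) (hz : G.weight o l z ≤ G.weight o l a / 2) :
    ∃ A ⊆ G.nearEdges o l, (G.weight o l a) ^ 3 / 8 ≤
      ∑ e ∈ A, (G.weight o l (G.endA e) - G.weight o l (G.endB e)) ^ 2 := by
  classical
  set w := G.weight o l with hw
  set M := w a with hM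
  obtain ⟨k, x, hk, hx0, hadj, hinj, hgt, hle⟩ :=
    hG.exists_descending_path (w := w) (c := M / 2) (a := a) (by linarith) hz
  let e : Fin k → G.edgeSet := fun i => ⟨s(x i, x (i + 1)), G.mem_edgeSet.2 (hadj i i.2)⟩
  have he : Function.Injective e := by
    intro i j hij
    have h1 : s(x i, x (i + 1)) = s(x j, x (j + 1)) := congrArg Subtype.val hij
    have hi := i.2
    have hj := j.2
    rw [Sym2.eq_iff] at h1
    rcases h1 with ⟨h1, -⟩ | ⟨h1, h2⟩
    · exact Fin.ext (hinj hi.le hj.le h1)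
    · have h3 := hinj (x₁ := (i : ℕ)) (x₂ := j + 1) hi.le hj h1
      have h4 := hinj (x₁ := (i : ℕ) + 1) (x₂ := j) hi hj.le h2
      omega
  refine ⟨Finset.univ.map ⟨e, he⟩, fun e' he' => ?_, ?_⟩
  · obtain ⟨i, -, rfl⟩ := Finset.mem_map.1 he'
    refine G.mem_nearEdges.2 ⟨x i, ?_, x i, Or.inl rfl, Sym2.mem_mk_left _ _⟩
    have := hgt i i.2
    exact ((half_pos ha).trans this).ne'
  · rw [Finset.sum_map]
    have h1 : ∑ i : Fin k, (w (G.endA (e i)) - w (G.endB (e i))) ^ 2 =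
        ∑ i ∈ Finset.range k, (w (x i) - w (x (i + 1))) ^ 2 := by
      rw [Finset.sum_range]
      exact Finset.sum_congr rfl fun i _ => sq_ends_sub rfl w
    change _ ≤ ∑ i : Fin k, (w (G.endA (e i)) - w (G.endB (e i))) ^ 2
    rw [h1]
    have h2 : ∑ i ∈ Finset.range k, (w (x i) - w (x (i + 1))) = M - w (x k) := by
      rw [Finset.sum_range_sub', hx0]
    -- Cauchy–Schwarz applied to the telescoping sum, which is at least `M / 2`.
    have h3 : (M / 2) ^ 2 ≤ k * ∑ i ∈ Finset.range k, (w (x i) - w (x (i + 1))) ^ 2 := by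
      have := sq_sum_le_card_mul_sum_sq (s := Finset.range k)
        (f := fun i => w (x i) - w (x (i + 1)))
      rw [h2, Finset.card_range] at this
      refine le_trans ?_ this
      gcongr
      linarith
    -- The first `k` vertices of the path are distinct and each carries mass above `M / 2`, out of a
    -- total of 1.
    have h4 : k * (M / 2) ≤ 1 := by
      have hinj' : InjOn x (Finset.range k : Set ℕ) := hinj.mono fun i hi => by
        simp at hi
        exact hi.le
      calc k * (M / 2) = ∑ _i ∈ Finset.range k, M / 2 := by simp
        _ ≤ ∑ i ∈ Finset.range k, w (x i) :=
          Finset.sum_le_sum fun i hi => (hgt i (Finset.mem_range.1 hi)).le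
        _ = ∑ v ∈ (Finset.range k).image x, w v := (Finset.sum_image hinj').symm
        _ ≤ ∑ v ∈ w.support, w v := by
          refine Finset.sum_le_sum_of_subset_of_nonneg (fun v hv => ?_)
            fun v _ _ => G.weight_nonneg o l v
          obtain ⟨i, hi, rfl⟩ := Finset.mem_image.1 hv
          exact Finsupp.mem_support_iff.2
            ((half_pos ha).trans (hgt i (Finset.mem_range.1 hi))).ne'
        _ = 1 := G.sum_weight o l
    set S := ∑ i ∈ Finset.range k, (w (x i) - w (x (i + 1))) ^ 2 with hS
    have hS0 : 0 ≤ S := Finset.sum_nonneg fun i _ => sq_nonneg _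
    have : (M / 2) ^ 2 * (M / 2) ≤ S := by
      calc (M / 2) ^ 2 * (M / 2) ≤ k * S * (M / 2) := by gcongr
        _ = k * (M / 2) * S := by ring
        _ ≤ 1 * S := by gcongr
        _ = S := one_mul S
    calc M ^ 3 / 8 = (M / 2) ^ 2 * (M / 2) := by ring
      _ ≤ S := this

/-- Take the largest weight: Σ w² ≤ max w · Σ w = max w. -/
lemma exists_weight_ge_sumSq (o : V) (l : List G.edgeSet) :
    ∃ a, 0 < G.weight o l a ∧ sumSq (G.weight o l) ≤ G.weight o l a := by
  set w := G.weight o l with hw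
  have hsum : ∑ v ∈ w.support, w v = 1 := G.sum_weight o l
  have hne : w.support.Nonempty := by
    rw [Finset.nonempty_iff_ne_empty]
    intro h
    rw [h] at hsum
    simp at hsum
  obtain ⟨a, ha, hmax⟩ := w.support.exists_max_image w hne
  refine ⟨a, (G.weight_nonneg o l a).lt_of_ne' (Finsupp.mem_support_iff.1 ha), ?_⟩
  calc sumSq w = ∑ v ∈ w.support, w v ^ 2 := sumSq_eq w
    _ ≤ ∑ v ∈ w.support, w a * w v := Finset.sum_le_sum fun v hv => by
        rw [pow_two]; exact mul_le_mul_of_nonneg_right (hmax v hv) (G.weight_nonneg o l v)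
    _ = w a := by rw [← Finset.mul_sum, hsum, mul_one]

lemma weight_le_one (o : V) (l : List G.edgeSet) (v : V) : G.weight o l v ≤ 1 := by
  by_cases hv : v ∈ (G.weight o l).support
  · rw [← G.sum_weight o l]
    exact Finset.single_le_sum (f := G.weight o l) (fun v _ => G.weight_nonneg o l v) hv
  · rw [Finsupp.notMem_support_iff.1 hv]; exact zero_le_one

/-- If all weights exceeded `c`, the finite support would be all of `V`, and the total mass would
exceed c|V| ≥ q|V|/2 ≥ 1. -/
lemma exists_weight_le {q : ℝ} (hq : Finite V → 2 ≤ q * Nat.card V) (o : V) (l : List G.edgeSet)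
    {c : ℝ} (hc : 0 ≤ c) (hqc : q < 2 * c) : ∃ z, G.weight o l z ≤ c := by
  by_contra! hcon
  have hfin : Finite V := by
    refine Set.finite_univ_iff.1 ((G.weight o l).support.finite_toSet.subset fun v _ => ?_)
    exact Finsupp.mem_support_iff.2 (hc.trans_lt (hcon v)).ne'
  have := Fintype.ofFinite V
  have h1 : ∑ v, G.weight o l v = 1 := by
    rw [← G.sum_weight o l]
    refine (Finset.sum_subset (Finset.subset_univ _) fun v _ hv => ?_).symm
    exact Finsupp.notMem_support_iff.1 hv
  have h2 : ∑ _v : V, c < ∑ v, G.weight o l v :=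
    Finset.sum_lt_sum_of_nonempty ⟨o, Finset.mem_univ o⟩ fun v _ => hcon v
  have h3 := hq hfin
  rw [Finset.sum_const, Finset.card_univ, nsmul_eq_mul, h1] at h2
  rw [Nat.card_eq_fintype_card] at h3
  have h4 : q * Fintype.card V ≤ 2 * c * Fintype.card V := by gcongr
  linarith

/-- This is the drift of `truncExp` at a ring: the cardinality is the total ring rate, which the
probability of silence later cancels, and `q / 17` is the net decay rate. -/
lemma sum_truncExp_le [G.LocallyFinite] (hG : G.Connected) {q : ℝ} (hq : 0 < q)
    (hfin : Finite V → 2 ≤ q * Nat.card V) (o : V) (l : List G.edgeSet) :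
    ∑ e ∈ G.nearEdges o l, truncExp q (sumSq (G.weight o (e :: l))) ≤
      ((G.nearEdges o l).card - q / 17) * truncExp q (sumSq (G.weight o l)) := by
  set w := G.weight o l with hw
  set Q := sumSq w with hQ
  set d : G.edgeSet → ℝ := fun e => (w (G.endA e) - w (G.endB e)) ^ 2 with hd
  have hstep : ∀ e, sumSq (G.weight o (e :: l)) = Q - d e / 2 := fun e =>
    sumSq_averageAt (G.adj_ends e).ne w
  have hd0 : ∀ e, 0 ≤ d e := fun e => sq_nonneg _
  simp_rw [hstep]
  rcases le_or_gt Q q with hQq | hQq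
  · have h0 : ∀ y, y ≤ Q → truncExp q y = 0 := fun y hy => if_neg (by linarith)
    rw [h0 Q le_rfl, mul_zero]
    exact (Finset.sum_eq_zero fun e _ => h0 _ (by linarith [hd0 e])).le
  obtain ⟨a, ha, hQa⟩ := exists_weight_ge_sumSq (G := G) o l
  change 0 < w a at ha
  change Q ≤ w a at hQa
  have hQ1 : Q ≤ 1 := hQa.trans (weight_le_one o l a)
  have hQ0 : 0 < Q := hq.trans hQq
  obtain ⟨z, hz⟩ := exists_weight_le (G := G) hfin o l (c := w a / 2) (by linarith) (by linarith)
  obtain ⟨A, hA, hsum⟩ := exists_edges_sum_sq_ge hG o l ha hz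
  set x : G.edgeSet → ℝ := fun e => d e / 2 / Q ^ 2 with hx
  have hx0 : ∀ e, 0 ≤ x e := fun e => by have := hd0 e; positivity
  have hD : Q / 16 ≤ ∑ e ∈ A, x e := by
    rw [hx, ← Finset.sum_div, ← Finset.sum_div, le_div_iff₀ (by positivity)]
    calc Q / 16 * Q ^ 2 = Q ^ 3 / 8 / 2 := by ring
      _ ≤ w a ^ 3 / 8 / 2 := by gcongr
      _ ≤ (∑ e ∈ A, d e) / 2 := by gcongr
  have hrate : q / 17 ≤ ∑ e ∈ G.nearEdges o l, x e / (1 + x e) := by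
    -- The right side equals Q/(16 + Q), which is at least Q/17 because Q ≤ 1.
    calc q / 17 ≤ Q / 16 / (1 + Q / 16) := by
          rw [div_le_div_iff₀ (by norm_num) (by positivity)]
          nlinarith
      _ ≤ (∑ e ∈ A, x e) / (1 + ∑ e ∈ A, x e) := by
          rw [div_le_div_iff₀ (by positivity) (by positivity)]
          nlinarith
      _ ≤ ∑ e ∈ A, x e / (1 + x e) := div_one_add_sum_le A hx0
      _ ≤ _ := Finset.sum_le_sum_of_subset_of_nonneg hA fun e _ _ => by
          have := hx0 e; positivity
  calc ∑ e ∈ G.nearEdges o l, truncExp q (Q - d e / 2)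
      ≤ ∑ e ∈ G.nearEdges o l, truncExp q Q * (1 - x e / (1 + x e)) :=
        Finset.sum_le_sum fun e _ => truncExp_sub_le hq.le hQq (by linarith [hd0 e])
    _ = truncExp q Q * ((G.nearEdges o l).card - ∑ e ∈ G.nearEdges o l, x e / (1 + x e)) := by
        rw [← Finset.mul_sum, Finset.sum_sub_distrib]; simp
    _ ≤ truncExp q Q * ((G.nearEdges o l).card - q / 17) := by
        have := truncExp_nonneg q Q
        gcongr
    _ = _ := mul_comm _ _

end SimpleGraph

end Energy

/-! ### Bounds for the history chain driven by Poisson counts -/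

section ChainBounds

open scoped ENNReal

variable {E Ω : Type*} [Countable E] [MeasurableSpace Ω] {P : Measure Ω} [IsProbabilityMeasure P]
  {F : List E → Finset E} {ξ : E × ℕ → Ω → ℕ} {h : ℝ≥0}

/-- Markov's inequality for a test function ψ whose mean grows at rate at most `r`. It is used with
`r > 0` for failure and `r < 0` for the sum of squares. -/
lemma measure_historyChain_mem_le (hξ : ∀ p, Measurable (ξ p)) (hi : iIndepFun ξ P)
    (hlaw : ∀ p, HasLaw (ξ p) (poissonMeasure h) P) {ψ : Option (List E) → ℝ} (hψ : ∀ s, 0 ≤ ψ s)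
    (r : ℝ) (hnone : ψ none ≤ Real.exp (h * r) * ψ none)
    (hsome : ∀ l, Real.exp (-(h * (F l).card)) *
      (ψ (some l) + h * ∑ e ∈ F l, ψ (some (e :: l))) + (h * (F l).card) ^ 2 * ψ none ≤
        Real.exp (h * r) * ψ (some l))
    (k : ℕ) {T : Set (Option (List E))} {a : ℝ} (ha : 0 ≤ a) (hT : ∀ s ∈ T, 1 ≤ a * ψ s) :
    P {ω | historyChain F (fun i e => ξ (e, i) ω) k ∈ T} ≤
      ENNReal.ofReal (a * (Real.exp (k * h * r) * ψ (some []))) := by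
  have hchain := lintegral_historyChain_le (F := F) hξ hi (fun s => ENNReal.ofReal (ψ s))
    (ENNReal.ofReal (Real.exp (h * r))) (fun s j => by
      rw [← ENNReal.ofReal_mul (Real.exp_nonneg _)]
      cases s with
      | none => simpa [historyStep] using ENNReal.ofReal_le_ofReal hnone
      | some l =>
        refine (lintegral_historyStep_le (fun e => hξ (e, j))
          (hi.precomp (g := fun e : E => (e, j)) fun e e' hee => (Prod.ext_iff.1 hee).1)
          (fun e => hlaw (e, j)) ψ hψ l).trans (ENNReal.ofReal_le_ofReal (hsome l))) k
  have hmeas : MeasurableSet {ω | historyChain F (fun i e => ξ (e, i) ω) k ∈ T} := by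
    have : {ω | historyChain F (fun i e => ξ (e, i) ω) k ∈ T} =
        ⋃ s ∈ T, {ω | historyChain F (fun i e => ξ (e, i) ω) k = s} := by ext; simp
    rw [this]
    exact MeasurableSet.biUnion (Set.to_countable T) fun s _ =>
      measurableSet_historyChain_eq F _ ξ k (fun e i _ => hξ _) s
  calc P {ω | historyChain F (fun i e => ξ (e, i) ω) k ∈ T}
      = ∫⁻ ω, {ω | historyChain F (fun i e => ξ (e, i) ω) k ∈ T}.indicator 1 ω ∂P :=
        (lintegral_indicator_one hmeas).symm
    _ ≤ ∫⁻ ω, ENNReal.ofReal a *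
          ENNReal.ofReal (ψ (historyChain F (fun i e => ξ (e, i) ω) k)) ∂P := by
        refine lintegral_mono fun ω => ?_
        by_cases hω : historyChain F (fun i e => ξ (e, i) ω) k ∈ T
        · rw [indicator_of_mem (by exact hω), ← ENNReal.ofReal_mul ha, Pi.one_apply,
            ← ENNReal.ofReal_one]
          exact ENNReal.ofReal_le_ofReal (hT _ hω)
        · rw [indicator_of_notMem (by exact hω)]
          exact zero_le
    _ = ENNReal.ofReal a *
          ∫⁻ ω, ENNReal.ofReal (ψ (historyChain F (fun i e => ξ (e, i) ω) k)) ∂P :=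
        lintegral_const_mul' _ _ ENNReal.ofReal_ne_top
    _ ≤ ENNReal.ofReal a * (ENNReal.ofReal (Real.exp (h * r)) ^ k *
          ENNReal.ofReal (ψ (some []))) := by gcongr
    _ = _ := by
        rw [← ENNReal.ofReal_pow (Real.exp_nonneg _), ← Real.exp_nat_mul,
          ← ENNReal.ofReal_mul (Real.exp_nonneg _), ← ENNReal.ofReal_mul ha, mul_assoc (k : ℝ)]

lemma measure_historyChain_eq_none_le (hξ : ∀ p, Measurable (ξ p)) (hi : iIndepFun ξ P)
    (hlaw : ∀ p, HasLaw (ξ p) (poissonMeasure h) P) {C : ℕ}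
    (hF : ∀ l, (F l).card ≤ (l.length + 1) * C) (k : ℕ) :
    P {ω | historyChain F (fun i e => ξ (e, i) ω) k = none} ≤
      ENNReal.ofReal (Real.exp (k * h * (3 * C + C ^ 2)) * h) := by
  -- A step fails with probability at most (hC(length + 1))², which is hC² times `ψ (some l)`. So
  -- failure, valued 1, adds only a bounded rate, while ψ starts at `h`.
  let ψ : Option (List E) → ℝ := fun s =>
    match s with
    | none => 1
    | some l => h * (l.length + 1) ^ 2
  have hψ : ∀ s, 0 ≤ ψ s := by
    rintro (_ | l)
    · exact zero_le_one
    · change 0 ≤ (h : ℝ) * (l.length + 1) ^ 2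
      positivity
  have := measure_historyChain_mem_le (F := F) hξ hi hlaw hψ (3 * C + C ^ 2) ?_ ?_ k
    (T := {none}) (a := 1) zero_le_one ?_
  · simpa [ψ] using this
  · change (1 : ℝ) ≤ Real.exp (h * (3 * C + C ^ 2)) * 1
    rw [mul_one]
    exact Real.one_le_exp (by positivity)
  · intro l
    have hL : ((F l).card : ℝ) ≤ (l.length + 1) * C := by exact_mod_cast hF l
    simp only [ψ, List.length_cons, Finset.sum_const, nsmul_eq_mul, Nat.cast_add, Nat.cast_one]
    set L : ℝ := Nat.cast (F l).card
    set s : ℝ := (l.length : ℝ) + 1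
    have hL0 : 0 ≤ L := Nat.cast_nonneg _
    have hs : 1 ≤ s := le_add_of_nonneg_left (Nat.cast_nonneg _)
    have hh : (0 : ℝ) ≤ h := h.2
    have hC : (0 : ℝ) ≤ C := Nat.cast_nonneg _
    have e1 : Real.exp (-(h * L)) * (1 + h * L) ≤ 1 := by
      rw [Real.exp_neg, inv_mul_le_iff₀ (Real.exp_pos _)]
      linarith [Real.add_one_le_exp (h * L)]
    have e2 : Real.exp (-(h * L)) ≤ 1 := Real.exp_le_one_iff.2 (by
      have := mul_nonneg hh hL0; linarith)
    -- A recorded ring raises s² by 2s + 1 ≤ 3s, at total rate at most sC. This is the term `3 * C`;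
    -- failure contributes `C ^ 2`.
    have e3 : h * L * (h * (2 * s + 1)) ≤ h * s ^ 2 * (h * (3 * C)) := by
      have : L * (2 * s + 1) ≤ s * C * (3 * s) := by gcongr; linarith
      calc h * L * (h * (2 * s + 1)) = h * h * (L * (2 * s + 1)) := by ring
        _ ≤ h * h * (s * C * (3 * s)) := by gcongr
        _ = _ := by ring
    have e4 : (h * L) ^ 2 ≤ h * s ^ 2 * (h * C ^ 2) := by
      calc (h * L) ^ 2 ≤ (h * (s * C)) ^ 2 := by gcongr
        _ = _ := by ring
    have e5 : 0 ≤ h * s ^ 2 := by positivity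
    have e6 : 0 ≤ h * L * (h * (2 * s + 1)) := by positivity
    calc Real.exp (-(h * L)) * (h * s ^ 2 + h * (L * (h * (s + 1) ^ 2))) + (h * L) ^ 2 * 1
        = Real.exp (-(h * L)) * (1 + h * L) * (h * s ^ 2)
          + Real.exp (-(h * L)) * (h * L * (h * (2 * s + 1))) + (h * L) ^ 2 := by ring
      _ ≤ 1 * (h * s ^ 2) + 1 * (h * L * (h * (2 * s + 1))) + (h * L) ^ 2 := by gcongr
      _ ≤ (h * (3 * C + C ^ 2) + 1) * (h * s ^ 2) := by linarith
      _ ≤ Real.exp (h * (3 * C + C ^ 2)) * (h * s ^ 2) := by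
        gcongr
        exact Real.add_one_le_exp _
  · rintro s rfl
    simp [ψ]

end ChainBounds

lemma measure_sumSq_weight_gt_le {V Ω : Type*} {G : SimpleGraph V} [G.LocallyFinite]
    [Countable V] [MeasurableSpace Ω] {P : Measure Ω} [IsProbabilityMeasure P]
    {ξ : G.edgeSet × ℕ → Ω → ℕ} {h : ℝ≥0} (hG : G.Connected) (hξ : ∀ p, Measurable (ξ p))
    (hi : iIndepFun ξ P) (hlaw : ∀ p, HasLaw (ξ p) (poissonMeasure h) P) {q : ℝ} (hq : 0 < q)
    (hfin : Finite V → 2 ≤ q * Nat.card V) (o : V) (k : ℕ) :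
    P {ω | ∃ l, historyChain (G.nearEdges o) (fun i e => ξ (e, i) ω) k = some l ∧
        q < sumSq (G.weight o l)} ≤ ENNReal.ofReal (Real.exp (1 / q - k * h * (q / 17))) := by
  have hce : Countable G.edgeSet := by
    have : Countable (Sym2 V) := inferInstanceAs (Countable (Quot _))
    infer_instance
  -- Failure is given the value 0 here, so it adds nothing to the mean; its probability is bounded
  -- separately.
  let ψ : Option (List G.edgeSet) → ℝ := fun s =>
    match s with
    | none => 0
    | some l => truncExp q (sumSq (G.weight o l))
  have hψ : ∀ s, 0 ≤ ψ s := by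
    rintro (_ | l)
    · exact le_rfl
    · exact truncExp_nonneg _ _
  have := measure_historyChain_mem_le (F := G.nearEdges o) hξ hi hlaw hψ (-(q / 17)) ?_ ?_ k
    (T := {s | ∃ l, s = some l ∧ q < sumSq (G.weight o l)}) (a := Real.exp (1 / q))
    (Real.exp_nonneg _) ?_
  · refine this.trans (ENNReal.ofReal_le_ofReal ?_)
    have h1 : ψ (some []) ≤ 1 := by
      change truncExp q (sumSq (G.weight o [])) ≤ 1
      unfold truncExp
      split_ifs with h1
      · exact Real.exp_le_one_iff.2 (div_nonpos_of_nonpos_of_nonneg (by norm_num) (hq.trans h1).le)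
      · exact zero_le_one
    calc Real.exp (1 / q) * (Real.exp (k * h * -(q / 17)) * ψ (some []))
        ≤ Real.exp (1 / q) * (Real.exp (k * h * -(q / 17)) * 1) := by gcongr
      _ = Real.exp (1 / q - k * h * (q / 17)) := by
        rw [mul_one, ← Real.exp_add]
        congr 1; ring
  · simp [ψ]
  · intro l
    have h1 := G.sum_truncExp_le hG hq hfin o l
    simp only [ψ, mul_zero, add_zero]
    set L : ℝ := Nat.cast (G.nearEdges o l).card
    set y := truncExp q (sumSq (G.weight o l))
    have hy : 0 ≤ y := truncExp_nonneg _ _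
    calc Real.exp (-(h * L)) *
          (y + h * ∑ e ∈ G.nearEdges o l, truncExp q (sumSq (G.weight o (e :: l))))
        ≤ Real.exp (-(h * L)) * (y + h * ((L - q / 17) * y)) := by gcongr
      _ = Real.exp (-(h * L)) * (h * (L - q / 17) + 1) * y := by ring
      _ ≤ Real.exp (-(h * L)) * Real.exp (h * (L - q / 17)) * y := by
        gcongr
        exact Real.add_one_le_exp _
      _ = Real.exp (h * -(q / 17)) * y := by
        rw [← Real.exp_add]
        congr 2; ring
  · rintro s ⟨l, rfl, hl⟩
    change 1 ≤ Real.exp (1 / q) * truncExp q (sumSq (G.weight o l))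
    rw [truncExp, if_pos hl, ← Real.exp_add]
    refine Real.one_le_exp ?_
    have : 1 / sumSq (G.weight o l) ≤ 1 / q := one_div_le_one_div_of_le hq hl.le
    rw [neg_div]
    linarith

/-! ### The increments of the clocks -/

lemma IsEdgeAveragingProcess.iIndepFun_increments {V Ω : Type*} [MeasurableSpace Ω]
    {G : SimpleGraph V} {N : G.edgeSet → ℝ≥0 → Ω → ℕ} {f : ℝ≥0 → V → Ω → ℝ} {P : Measure Ω}
    [IsProbabilityMeasure P] (hf : IsEdgeAveragingProcess G N f P) {τ : ℕ → ℝ≥0}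
    (hτ : Monotone τ) :
    iIndepFun (fun (p : G.edgeSet × ℕ) ω => N p.1 (τ (p.2 + 1)) ω - N p.1 (τ p.2) ω) P := by
  refine iIndepFun_uncurry' (X := fun e i ω => N e (τ (i + 1)) ω - N e (τ i) ω)
    (fun e i => ((hf.clock e).measurable _).sub ((hf.clock e).measurable _)) ?_
    fun e => (hf.clock e).indepIncrements.nat hτ
  exact hf.clock_indep.comp (fun _ (p : ℝ≥0 → ℕ) (i : ℕ) => p (τ (i + 1)) - p (τ i))
    fun _ => measurable_pi_lambda _ fun i => (measurable_pi_apply _).sub (measurable_pi_apply _)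

/-- Reversal of `0, …, K - 1`. -/
def reverseIndex (K k : ℕ) : ℕ := if k < K then K - 1 - k else k

lemma reverseIndex_injective (K : ℕ) : Function.Injective (reverseIndex K) := by
  intro a b hab
  unfold reverseIndex at hab
  split_ifs at hab <;> omega

lemma historyStep_eq_some {E : Type*} {F : List E → Finset E} {s : Option (List E)} {n : E → ℕ}
    {l' : List E} (h : historyStep F s n = some l') :
    ∃ l, s = some l ∧ ((l' = l ∧ ∀ e ∈ F l, n e = 0) ∨
      ∃ e, l' = e :: l ∧ IsSingleRing F l n e) := by
  cases s with
  | none => simp [historyStep] at h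
  | some l =>
    refine ⟨l, rfl, ?_⟩
    by_cases h0 : ∀ e ∈ F l, n e = 0
    · rw [historyStep_of_silent h0] at h
      exact Or.inl ⟨(Option.some.inj h).symm, h0⟩
    by_cases h1 : ∃ e, IsSingleRing F l n e
    · obtain ⟨e, he⟩ := h1
      rw [historyStep_of_isSingleRing he] at h
      exact Or.inr ⟨e, (Option.some.inj h).symm, he⟩
    · rw [historyStep_of_not h0 h1] at h
      simp at h

/-- Step `k` of the chain reads the window from τ(K - k - 1) to τ(K - k), so each update pushes the
weights one window further into the past. -/
lemma FollowsEdgeAveraging.linearCombination_historyChain {V : Type*} {G : SimpleGraph V}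
    [G.LocallyFinite] {n : G.edgeSet → ℝ≥0 → ℕ} {x : ℝ≥0 → V → ℝ}
    (hx : FollowsEdgeAveraging G n x) (hm : ∀ e, Monotone (n e))
    (hc : ∀ e t, ContinuousWithinAt (n e) (Ici t) t) (o : V) {τ : ℕ → ℝ≥0} (hτ : Monotone τ)
    (K k : ℕ) (hk : k ≤ K) (l : List G.edgeSet)
    (hl : historyChain (G.nearEdges o)
      (fun i e => n e (τ (reverseIndex K i + 1)) - n e (τ (reverseIndex K i))) k = some l) :
    x (τ K) o = Finsupp.linearCombination ℝ (x (τ (K - k))) (G.weight o l) := by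
  induction k generalizing l with
  | zero =>
    obtain rfl : [] = l := Option.some.inj hl
    simp [SimpleGraph.weight]
  | succ k ih =>
    obtain ⟨l₀, hl₀, hcase⟩ := historyStep_eq_some hl
    rw [ih (by omega) l₀ hl₀]
    have hr : reverseIndex K k = K - (k + 1) := by
      unfold reverseIndex; split_ifs <;> omega
    have hr' : K - (k + 1) + 1 = K - k := by omega
    beta_reduce at hcase
    rw [hr, hr'] at hcase
    have hle : τ (K - (k + 1)) ≤ τ (K - k) := hτ (by omega)
    have hsil : ∀ e, n e (τ (K - k)) - n e (τ (K - (k + 1))) = 0 →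
        n e (τ (K - k)) = n e (τ (K - (k + 1))) := fun e he => by
      have := hm e hle
      omega
    rcases hcase with ⟨rfl, h0⟩ | ⟨e, rfl, he, he1, he0⟩
    · exact hx.linearCombination_eq_of_silent hm hle fun e he => hsil e (h0 e he)
    · refine hx.linearCombination_eq_of_single_ring hm hc hle ?_
        fun e' he' hne => hsil e' (he0 e' he' hne)
      have he2 : n e (τ (K - k)) - n e (τ (K - (k + 1))) = 1 := he1
      omega

/-! ### Concentration for given weights -/

lemma measure_le_abs_linearCombination_sub_le {V Ω : Type*} [MeasurableSpace Ω] {P : Measure Ω}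
    [IsProbabilityMeasure P] {X : V → Ω → ℝ} (hmeas : ∀ v, Measurable (X v))
    (hindep : iIndepFun X P) (hbdd : ∀ v, ∀ᵐ ω ∂P, X v ω ∈ Icc (-1 : ℝ) 1) {μ : ℝ}
    (hμ : ∀ v, ∫ ω, X v ω ∂P = μ) (w : V →₀ ℝ)
    (hw : Finsupp.linearCombination ℝ (fun _ => (1 : ℝ)) w = 1) {ε : ℝ} (hε : 0 ≤ ε) :
    P {ω | ε ≤ |Finsupp.linearCombination ℝ (fun v => X v ω) w - μ|} ≤
      ENNReal.ofReal (2 * Real.exp (-ε ^ 2 / (2 * sumSq w))) := by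
  have hcent : ∀ ω, Finsupp.linearCombination ℝ (fun v => X v ω) w - μ =
      ∑ v ∈ w.support, w v * (X v ω - μ) := by
    intro ω
    rw [linearCombination_eq_sum] at hw ⊢
    simp only [mul_one] at hw
    simp_rw [mul_sub]
    rw [Finset.sum_sub_distrib, ← Finset.sum_mul, hw, one_mul]
  -- Hoeffding's lemma on an interval of length 2 gives variance proxy 1, scaled by c².
  have hsub : ∀ c : ℝ, ∀ v, HasSubgaussianMGF (fun ω => c * (X v ω - μ))
      (‖c‖₊ ^ 2) P := by
    intro c v
    have h1 := (hasSubgaussianMGF_of_mem_Icc (hmeas v).aemeasurable (hbdd v)).const_mul c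
    rw [hμ v] at h1
    convert h1 using 1
    apply NNReal.coe_injective
    change ‖c‖ ^ 2 = c ^ 2 * (‖(1 : ℝ) - -1‖ / 2) ^ 2
    rw [Real.norm_eq_abs, sq_abs]
    norm_num
  have hone : ∀ σ : ℝ, σ ^ 2 = 1 →
      P {ω | ε ≤ σ * (Finsupp.linearCombination ℝ (fun v => X v ω) w - μ)} ≤
        ENNReal.ofReal (Real.exp (-ε ^ 2 / (2 * sumSq w))) := by
    intro σ hσ
    have h1 : iIndepFun (fun v ω => σ * w v * (X v ω - μ)) P :=
      hindep.comp (fun v x => σ * w v * (x - μ)) fun v => by fun_prop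
    have h2 := HasSubgaussianMGF.measure_sum_ge_le_of_iIndepFun h1 (s := w.support)
      (fun v _ => hsub (σ * w v) v) hε
    have h3 : ((∑ v ∈ w.support, ‖σ * w v‖₊ ^ 2 : ℝ≥0) : ℝ) = sumSq w := by
      rw [NNReal.coe_sum, sumSq_eq]
      exact Finset.sum_congr rfl fun v _ => by
        rw [NNReal.coe_pow, coe_nnnorm, Real.norm_eq_abs, sq_abs, mul_pow, hσ, one_mul]
    have h4 : ∀ ω, σ * (Finsupp.linearCombination ℝ (fun v => X v ω) w - μ) =
        ∑ v ∈ w.support, σ * w v * (X v ω - μ) := by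
      intro ω
      rw [hcent, Finset.mul_sum]
      exact Finset.sum_congr rfl fun v _ => by ring
    simp_rw [h4]
    rw [← ofReal_measureReal]
    refine ENNReal.ofReal_le_ofReal (h2.trans_eq ?_)
    rw [h3]
  have hsubset : {ω | ε ≤ |Finsupp.linearCombination ℝ (fun v => X v ω) w - μ|} ⊆
      {ω | ε ≤ 1 * (Finsupp.linearCombination ℝ (fun v => X v ω) w - μ)} ∪
      {ω | ε ≤ -1 * (Finsupp.linearCombination ℝ (fun v => X v ω) w - μ)} := by
    intro ω hω
    rcases le_abs'.1 (show ε ≤ |_| from hω) with h | h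
    · right; change ε ≤ -1 * _; linarith
    · left; change ε ≤ 1 * _; linarith
  refine (measure_mono hsubset).trans ((measure_union_le _ _).trans ?_)
  refine (add_le_add (hone 1 (by norm_num)) (hone (-1) (by norm_num))).trans_eq ?_
  rw [← ENNReal.ofReal_add (Real.exp_nonneg _) (Real.exp_nonneg _), ← two_mul]

/-! ### The main estimate -/

lemma SimpleGraph.Connected.countable {V : Type*} {G : SimpleGraph V} [G.LocallyFinite]
    (hG : G.Connected) : Countable V := by
  obtain ⟨o⟩ := hG.nonempty
  let B : ℕ → Set V := fun k => Nat.rec {o} (fun _ S => ⋃ v ∈ S, G.neighborSet v) k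
  have hB : ∀ k, (B k).Countable := by
    intro k
    induction k with
    | zero => exact Set.countable_singleton o
    | succ k ih => exact ih.biUnion fun v _ => (Set.toFinite (G.neighborSet v)).countable
  have hreach : ∀ u v (_ : G.Walk u v), u ∈ ⋃ k, B k → v ∈ ⋃ k, B k := by
    intro u v p
    induction p with
    | nil => exact id
    | cons h _ ih =>
      intro hu
      obtain ⟨k, hk⟩ := Set.mem_iUnion.1 hu
      exact ih (Set.mem_iUnion.2 ⟨k + 1, Set.mem_biUnion hk h⟩)
  refine Set.countable_univ_iff.1 ((Set.countable_iUnion hB).mono fun v _ => ?_)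
  obtain ⟨p⟩ := hG.preconnected o v
  exact hreach o v p (Set.mem_iUnion.2 ⟨0, rfl⟩)

namespace IsEdgeAveragingProcess

variable {V Ω : Type*} [MeasurableSpace Ω] {G : SimpleGraph V} {N : G.edgeSet → ℝ≥0 → Ω → ℕ}
  {f : ℝ≥0 → V → Ω → ℝ} {P : Measure Ω} [IsProbabilityMeasure P] [G.LocallyFinite]

lemma measure_deviation_le_of_step (hf : IsEdgeAveragingProcess G N f P) (hG : G.Connected)
    {Δ : ℕ} (hΔ : ∀ v, G.degree v ≤ Δ) (hindep : iIndepFun (f 0) P)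
    (hbdd : ∀ v, ∀ᵐ ω ∂P, f 0 v ω ∈ Icc (-1 : ℝ) 1) {μ : ℝ} (hμ : ∀ v, ∫ ω, f 0 v ω ∂P = μ)
    (o : V) {q : ℝ} (hq : 0 < q) (hfin : Finite V → 2 ≤ q * Nat.card V) {ε : ℝ} (hε : 0 ≤ ε)
    (h : ℝ≥0) (K : ℕ) :
    P {ω | ε ≤ |f (K * h) o ω - μ|} ≤
      ENNReal.ofReal (Real.exp (K * h * (3 * ((Δ + 1) * Δ : ℕ) + ((Δ + 1) * Δ : ℕ) ^ 2)) * h) +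
      ENNReal.ofReal (Real.exp (1 / q - K * h * (q / 17))) +
      ENNReal.ofReal (2 * Real.exp (-ε ^ 2 / (2 * q))) := by
  have hcV : Countable V := hG.countable
  have hce : Countable G.edgeSet := by
    have : Countable (Sym2 V) := inferInstanceAs (Countable (Quot _))
    infer_instance
  set τ : ℕ → ℝ≥0 := fun i => i * h with hτdef
  have hτ : Monotone τ := fun i j hij => by
    simp only [hτdef]
    gcongr
  -- Clock increments in reversed order. Beyond `K` the index is unchanged, so the reindexing is
  -- injective on ℕ and the whole family stays independent.
  set ξ : G.edgeSet × ℕ → Ω → ℕ := fun p ω =>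
    N p.1 (τ (reverseIndex K p.2 + 1)) ω - N p.1 (τ (reverseIndex K p.2)) ω with hξdef
  have hξ : ∀ p, Measurable (ξ p) := fun p =>
    ((hf.clock p.1).measurable _).sub ((hf.clock p.1).measurable _)
  have hi : iIndepFun ξ P :=
    (hf.iIndepFun_increments hτ).precomp
      (g := fun p : G.edgeSet × ℕ => (p.1, reverseIndex K p.2)) fun p p' hpp => by
        simp only [Prod.mk.injEq] at hpp
        exact Prod.ext hpp.1 (reverseIndex_injective K hpp.2)
  have hlaw : ∀ p, HasLaw (ξ p) (poissonMeasure h) P := by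
    intro p
    have h1 := (hf.clock p.1).law (τ (reverseIndex K p.2)) (τ (reverseIndex K p.2 + 1))
      (hτ (Nat.le_succ _))
    have h2 : τ (reverseIndex K p.2 + 1) - τ (reverseIndex K p.2) = h := by
      simp only [hτdef]
      push_cast
      rw [add_mul, one_mul, add_tsub_cancel_left]
    rwa [h2] at h1
  set S : Ω → Option (List G.edgeSet) := fun ω =>
    historyChain (G.nearEdges o) (fun i e => ξ (e, i) ω) K with hS
  set D : List G.edgeSet → Set Ω := fun l =>
    {ω | ε ≤ |Finsupp.linearCombination ℝ (fun v => f 0 v ω) (G.weight o l) - μ|} with hD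
  have hnone : P {ω | S ω = none} ≤ _ := measure_historyChain_eq_none_le (F := G.nearEdges o)
    hξ hi hlaw (G.card_nearEdges_le hΔ o) K
  have hlarge := measure_sumSq_weight_gt_le hG hξ hi hlaw hq hfin o K
  have hDmeas : ∀ l, MeasurableSet[MeasurableSpace.comap (fun ω v => f 0 v ω) inferInstance]
      (D l) := by
    intro l
    refine ⟨{y | ε ≤ |Finsupp.linearCombination ℝ y (G.weight o l) - μ|}, ?_, rfl⟩
    simp_rw [linearCombination_eq_sum]
    refine measurableSet_le measurable_const ?_
    fun_prop
  have hSmeas : ∀ s, MeasurableSet[MeasurableSpace.comap (fun ω e t => N e t ω) inferInstance]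
      {ω | S ω = s} := by
    intro s
    refine measurableSet_historyChain_eq _ _ ξ K (fun e i _ => ?_) s
    have h1 : Measurable fun y : G.edgeSet → ℝ≥0 → ℕ =>
        y e (τ (reverseIndex K i + 1)) - y e (τ (reverseIndex K i)) := by fun_prop
    exact h1.comp (comap_measurable _)
  -- Conditioning on the history: `S` is a function of the clocks and `D l` of the initial opinions,
  -- so the probabilities factor for each of the countably many `l`.
  have hgood : P (⋃ l, {ω | S ω = some l} ∩ {ω | sumSq (G.weight o l) ≤ q ∧ ω ∈ D l}) ≤
      ENNReal.ofReal (2 * Real.exp (-ε ^ 2 / (2 * q))) := by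
    have hterm : ∀ l, P ({ω | S ω = some l} ∩ {ω | sumSq (G.weight o l) ≤ q ∧ ω ∈ D l}) ≤
        P {ω | S ω = some l} * ENNReal.ofReal (2 * Real.exp (-ε ^ 2 / (2 * q))) := by
      intro l
      by_cases hl : sumSq (G.weight o l) ≤ q
      · have h1 : {ω | S ω = some l} ∩ {ω | sumSq (G.weight o l) ≤ q ∧ ω ∈ D l} =
            {ω | S ω = some l} ∩ D l := by ext; simp [hl]
        rw [h1, inter_comm, (Indep_iff _ _ _).1 ((IndepFun_iff_Indep _ _ _).1
          hf.initial_indep_clock) _ _ (hDmeas l) (hSmeas (some l)), mul_comm]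
        gcongr
        refine (measure_le_abs_linearCombination_sub_le hf.initial_measurable hindep hbdd hμ _
          (G.linearCombination_one_weight o l) hε).trans (ENNReal.ofReal_le_ofReal ?_)
        have hpos : 0 < sumSq (G.weight o l) := by
          rw [sumSq_eq]
          obtain ⟨a, ha, -⟩ := SimpleGraph.exists_weight_ge_sumSq (G := G) o l
          exact Finset.sum_pos (fun v hv => by
            have := Finsupp.mem_support_iff.1 hv; positivity)
            ⟨a, Finsupp.mem_support_iff.2 ha.ne'⟩
        rw [neg_div, neg_div]
        gcongr
      · have h1 : {ω | S ω = some l} ∩ {ω | sumSq (G.weight o l) ≤ q ∧ ω ∈ D l} = ∅ := by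
          ext; simp [hl]
        rw [h1, measure_empty]
        exact zero_le
    calc _ ≤ ∑' l, P ({ω | S ω = some l} ∩ {ω | sumSq (G.weight o l) ≤ q ∧ ω ∈ D l}) :=
          measure_iUnion_le _
      _ ≤ ∑' l, P {ω | S ω = some l} * ENNReal.ofReal (2 * Real.exp (-ε ^ 2 / (2 * q))) :=
          ENNReal.tsum_le_tsum hterm
      _ = P (⋃ l, {ω | S ω = some l}) * ENNReal.ofReal (2 * Real.exp (-ε ^ 2 / (2 * q))) := by
          rw [ENNReal.tsum_mul_right, measure_iUnion]
          · intro l l' hne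
            refine Set.disjoint_left.2 fun ω h1 h2 => hne ?_
            exact Option.some.inj (Eq.trans (Eq.symm h1) h2)
          · exact fun l => measurableSet_historyChain_eq _ _ ξ K (fun e i _ => hξ _) _
      _ ≤ 1 * ENNReal.ofReal (2 * Real.exp (-ε ^ 2 / (2 * q))) := by
          gcongr
          exact prob_le_one
      _ = _ := one_mul _
  have hmono : ∀ᵐ ω ∂P, ∀ e, Monotone fun t => N e t ω :=
    ae_all_iff.2 fun e => (hf.clock e).monotone
  have hcont : ∀ᵐ ω ∂P, ∀ e, ∀ t, ContinuousWithinAt (fun s => N e s ω) (Ici t) t :=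
    ae_all_iff.2 fun e => (hf.clock e).rightContinuous
  have hsub : ({ω | ε ≤ |f (K * h) o ω - μ|} : Set Ω) ≤ᵐ[P]
      (({ω | S ω = none} ∪ {ω | ∃ l, S ω = some l ∧ q < sumSq (G.weight o l)}) ∪
      ⋃ l, {ω | S ω = some l} ∩ {ω | sumSq (G.weight o l) ≤ q ∧ ω ∈ D l} : Set Ω) := by
    filter_upwards [hf.follows, hmono, hcont] with ω hω hm hc hdev
    replace hdev : ε ≤ |f (K * h) o ω - μ| := hdev
    cases hs : S ω with
    | none => exact Or.inl (Or.inl hs)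
    | some l =>
      by_cases hl : sumSq (G.weight o l) ≤ q
      · refine Or.inr (mem_iUnion.2 ⟨l, hs, hl, ?_⟩)
        have h1 := hω.linearCombination_historyChain hm hc o hτ K K le_rfl l hs
        have h2 : τ (K - K) = 0 := by simp [hτdef]
        rw [h2] at h1
        change ε ≤ |_ - μ|
        rw [← h1]
        exact hdev
      · exact Or.inl (Or.inr ⟨l, hs, not_le.1 hl⟩)
  refine (measure_mono_ae hsub).trans ((measure_union_le _ _).trans ?_)
  exact add_le_add ((measure_union_le _ _).trans (add_le_add hnone hlarge)) hgood

/-- Take K + 1 steps of length t/(K + 1) and let K tend to infinity: only the failure term depends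
on K, and it vanishes. -/
lemma measureReal_deviation_le (hf : IsEdgeAveragingProcess G N f P) (hG : G.Connected)
    {Δ : ℕ} (hΔ : ∀ v, G.degree v ≤ Δ) (hindep : iIndepFun (f 0) P)
    (hbdd : ∀ v, ∀ᵐ ω ∂P, f 0 v ω ∈ Icc (-1 : ℝ) 1) {μ : ℝ} (hμ : ∀ v, ∫ ω, f 0 v ω ∂P = μ)
    (o : V) {q : ℝ} (hq : 0 < q) (hfin : Finite V → 2 ≤ q * Nat.card V) {ε : ℝ} (hε : 0 ≤ ε)
    (t : ℝ≥0) :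
    P.real {ω | ε ≤ |f t o ω - μ|} ≤
      Real.exp (1 / q - t * (q / 17)) + 2 * Real.exp (-ε ^ 2 / (2 * q)) := by
  set R : ℝ := 3 * ((Δ + 1) * Δ : ℕ) + ((Δ + 1) * Δ : ℕ) ^ 2 with hR
  have hK : ∀ K : ℕ, P.real {ω | ε ≤ |f t o ω - μ|} ≤
      Real.exp (t * R) * (t / ((K : ℝ) + 1)) +
        (Real.exp (1 / q - t * (q / 17)) + 2 * Real.exp (-ε ^ 2 / (2 * q))) := by
    intro K
    have h1 := hf.measure_deviation_le_of_step hG hΔ hindep hbdd hμ o hq hfin hε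
      (t / ((K + 1 : ℕ) : ℝ≥0)) (K + 1)
    have h2 : ((K + 1 : ℕ) : ℝ≥0) * (t / ((K + 1 : ℕ) : ℝ≥0)) = t :=
      mul_div_cancel₀ t (by positivity)
    have h3 : ((K + 1 : ℕ) : ℝ) * ((t / ((K + 1 : ℕ) : ℝ≥0) : ℝ≥0) : ℝ) = t := by
      exact_mod_cast congrArg NNReal.toReal h2
    rw [h2, h3, ← hR, ← ENNReal.ofReal_add (by positivity) (by positivity),
      ← ENNReal.ofReal_add (by positivity) (by positivity)] at h1
    have h4 := ENNReal.toReal_le_of_le_ofReal (by positivity) h1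
    rw [measureReal_def]
    refine h4.trans_eq ?_
    push_cast
    ring
  have hlim : Tendsto (fun K : ℕ => Real.exp (t * R) * (t / ((K : ℝ) + 1)) +
        (Real.exp (1 / q - t * (q / 17)) + 2 * Real.exp (-ε ^ 2 / (2 * q)))) atTop
      (𝓝 (Real.exp (t * R) * 0 +
        (Real.exp (1 / q - t * (q / 17)) + 2 * Real.exp (-ε ^ 2 / (2 * q))))) :=
    ((tendsto_const_div_atTop_nhds_zero_nat (t : ℝ)).comp (tendsto_add_atTop_nat 1) |>.congr
      (fun K => by simp)).const_mul _ |>.add_const _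
  rw [mul_zero, zero_add] at hlim
  exact ge_of_tendsto' hlim hK

end IsEdgeAveragingProcess

lemma SimpleGraph.exists_degree_bound {V : Type*} (G : SimpleGraph V)
    (hdeg : Finite V ∨ ∃ Δ : ℕ, ∀ v, (G.neighborSet v).encard ≤ Δ) :
    ∃ (_ : G.LocallyFinite) (Δ : ℕ), ∀ v, G.degree v ≤ Δ := by
  classical
  obtain ⟨Δ, hΔ⟩ : ∃ Δ : ℕ, ∀ v, (G.neighborSet v).encard ≤ Δ := by
    rcases hdeg with h | h
    · have := Fintype.ofFinite V
      refine ⟨Fintype.card V, fun v => ?_⟩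
      rw [Set.encard_eq_coe_toFinset_card]
      exact_mod_cast Finset.card_le_univ _
    · exact h
  have hfin : ∀ v, (G.neighborSet v).Finite := fun v =>
    Set.finite_of_encard_le_coe (hΔ v)
  let I : G.LocallyFinite := fun v => (hfin v).fintype
  refine ⟨I, Δ, fun v => ?_⟩
  have := hΔ v
  rw [Set.encard_eq_coe_toFinset_card] at this
  exact_mod_cast this

theorem mainTheorem2 {V : Type*} (G : SimpleGraph V) (hconn : G.Connected)
    (hdeg : Finite V ∨ ∃ Δ : ℕ, ∀ v, (G.neighborSet v).encard ≤ Δ)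
    {Ω : Type*} [MeasurableSpace Ω] (P : Measure Ω) [IsProbabilityMeasure P]
    (N : G.edgeSet → ℝ≥0 → Ω → ℕ) (f : ℝ≥0 → V → Ω → ℝ)
    (hf : IsEdgeAveragingProcess G N f P)
    (hindep : iIndepFun (f 0) P)
    (hident : ∀ u v, IdentDistrib (f 0 u) (f 0 v) P P)
    (hbdd : ∀ v, ∀ᵐ ω ∂P, f 0 v ω ∈ Icc (-1 : ℝ) 1)
    (o : V) (t : ℝ≥0) (ε : ℝ) (hε0 : 0 ≤ ε) (hε1 : ε < 1) :
    P.real {ω | ε ≤ |f t o ω - ∫ ω', f 0 o ω' ∂P|} ≤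
      3 * Real.exp (-(ε ^ 2 * √(tStar V t) / 12)) := by
  obtain ⟨_, Δ, hΔ⟩ := G.exists_degree_bound hdeg
  have hle : tStar V t ≤ t := by
    unfold tStar
    split_ifs
    · exact min_le_left _ _
    · exact le_rfl
  set T := √(tStar V t) with hT
  have hT0 : 0 ≤ T := Real.sqrt_nonneg _
  rcases hT0.eq_or_lt with h0 | hpos
  · rw [← h0]
    simp only [mul_zero, zero_div, neg_zero, Real.exp_zero, mul_one]
    exact measureReal_le_one.trans (by norm_num)
  have hTt : T ^ 2 ≤ t := by
    rw [hT, Real.sq_sqrt (Real.sqrt_pos.1 hpos).le]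
    exact hle
  have hTV : Finite V → T ≤ Nat.card V := by
    intro hV
    rw [hT, tStar, if_pos hV]
    exact Real.sqrt_le_iff.2 ⟨Nat.cast_nonneg _, min_le_right _ _⟩
  -- The choice q = 6/T turns the Hoeffding exponent into exactly -ε²T/12. As t ≥ T², the other
  -- exponent is at most T/6 - 6T/17 ≤ -T/12, and T ≤ |V| gives q|V| ≥ 6 in the finite case.
  have hmain := hf.measureReal_deviation_le hconn hΔ hindep hbdd
    (fun v => (hident v o).integral_eq) o (q := 6 / T) (by positivity)
    (fun hV => by
      have := hTV hV
      rw [div_mul_eq_mul_div, le_div_iff₀ hpos]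
      linarith) hε0 t
  have hε2 : ε ^ 2 ≤ 1 := by nlinarith
  have h1 : Real.exp (1 / (6 / T) - t * (6 / T / 17)) ≤ Real.exp (-(ε ^ 2 * T / 12)) := by
    refine Real.exp_le_exp.2 ?_
    have e1 : T ^ 2 * (6 / T / 17) ≤ t * (6 / T / 17) := by gcongr
    have e2 : T ^ 2 * (6 / T / 17) = 6 / 17 * T := by field_simp
    have e3 : 1 / (6 / T) = T / 6 := by field_simp
    have e4 : ε ^ 2 * T ≤ 1 * T := by gcongr
    rw [e3]
    linarith
  have h2 : -ε ^ 2 / (2 * (6 / T)) = -(ε ^ 2 * T / 12) := by field_simp; ring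
  rw [h2] at hmain
  linarith
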